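/- All graphs are finite, simple and undirected. A graph is *cop-win* if in the game of Cops and Robber a single cop can guarantee to capture the robber: the cop chooses a starting vertex, then the robber chooses one, then they alternately (the cop first) move to an adjacent vertex or stay put, and the cop wins when both occupy the same vertex. (The graph with no vertices is not cop-win.) For a graph $G$ and $p\in[0,1]$, the *node cop-win reliability* $\operatorname{NCRel}(G,p)$ is the probability that the operational vertices of $G$ induce a cop-win graph, when each vertex is operational independently with probability $p$; that is, $\operatorname{NCRel}(G,p)=\sum_{i=1}^{n}W_i(G)\,p^i(1-p)^{n-i}$, where $n=|V(G)|$ and $W_i(G)$ is the number of $i$-element vertex sets that induce a cop-win subgraph. A graph $G$ is *bicyclic* if it is connected and $|E(G)|=|V(G)|+1$. For $m\ge 3$ let $U_m$ be the graph $(K_2\cup\overline{K_{m-3}})\vee K_1$, and for $n\ge 4$ let $B_n$ be obtained from $U_{n-1}$ by adding a new vertex joined to a universal vertex $u$ of $U_{n-1}$ and to one vertex of degree $2$ other than $u$. **Corollary.** For every $n\ge 7$, $B_n$ is uniformly most reliable with respect to node cop-win reliability among all bicyclic graphs of order $n$: $B_n$ is a bicyclic graph of order $n$, and $\operatorname{NCRel}(G,p)\le\operatorname{NCRel}(B_n,p)$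 for all bicyclic graphs $G$ of order $n$ and all $p\in[0,1]$. -/

import Mathlib

/-- `CopWinsFrom G c r`: in the game of Cops and Robber on `G` with one cop, the cop stands on `c`,
the robber stands on `r`, it is the cop's turn, and the cop can force capture after finitely many
moves, whatever the robber does. In each turn a player stays or moves to an adjacent vertex. -/
inductive CopWinsFrom {V : Type*} (G : SimpleGraph V) : V → V → Prop
  /-- The cop already occupies, or can move onto, the robber's vertex. -/
  | capture (c r : V) (h : c = r ∨ G.Adj c r) : CopWinsFrom G c r
  /-- The cop goes from `c` to `c'` and wins after every possible reply `r'` of the robber. -/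
  | move (c c' r : V) (hc : c' = c ∨ G.Adj c c')
      (hr : ∀ r' : V, r' = r ∨ G.Adj r r' → CopWinsFrom G c' r') : CopWinsFrom G c r

/-- A graph is cop-win if the cop can choose a starting vertex such that, wherever the robber then
starts, the cop can force capture (the cop moving first). The graph without vertices is not
cop-win. -/
def IsCopWin {V : Type*} (G : SimpleGraph V) : Prop :=
  ∃ c : V, ∀ r : V, CopWinsFrom G c r

/-- The probability that exactly the nodes in `S` are operational, when each node of `V` is
operational independently with probability `p`. -/
def stateProb {V : Type*} [Fintype V] (p : ℝ) (S : Finset V) : ℝ :=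
  p ^ S.card * (1 - p) ^ (Fintype.card V - S.card)

open Classical in
/-- Node cop-win reliability: the probability that the set of operational nodes induces a cop-win
graph. -/
noncomputable def NCRel {V : Type*} [Fintype V] (G : SimpleGraph V) (p : ℝ) : ℝ :=
  ∑ S ∈ Finset.univ.filter (fun S : Finset V => IsCopWin (G.induce (S : Set V))), stateProb p S

/-- A bicyclic graph is a connected graph with `|V| + 1` edges. -/
def IsBicyclic {V : Type*} [Fintype V] (G : SimpleGraph V) : Prop :=
  G.Connected ∧ G.edgeSet.ncard = Fintype.card V + 1

/-- The graph `B_n` (meaningful for `4 ≤ n`). The vertices other than `3` induce `U_{n-1}`: the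
universal vertex `0`, the edge `12`, and leaves `4, …, n - 1`. The vertex `3` is joined to the
universal vertex `0` and to the vertex `2`, which has degree two in `U_{n-1}`. -/
def graphB (n : ℕ) : SimpleGraph (Fin n) :=
  SimpleGraph.fromRel fun i j : Fin n =>
    i.val = 0 ∨ (i.val = 1 ∧ j.val = 2) ∨ (i.val = 2 ∧ j.val = 3)

/-! The reliability is a nonnegative combination of the numbers $W_i$ of cop-win $i$-sets, so it
suffices to compare these numbers for each $i$. In $B_n$ every set containing the universal vertex
is cop-win, which gives $\binom{n-1}{i-1}$ sets; the vertices $1,2,3$ form a path that supplies two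
further pairs and one further triple, and there are $n-1$ further singletons. Any bicyclic graph
must be shown to have no more.

For $i\le 3$ this is edge counting. For $i=k+1\ge 4$ the bound $\binom{n-1}{k}$ is proved by
induction over connected sets of cyclomatic number $c\le 2$, with a small correction `excess`
(`copCount_le_choose_add_excess`). Across a bridge, a connected set lies on one side or contains
both ends of the bridge, and Pascal's rule with superadditivity of binomials adds up the three
counts.

A bridgeless set of positive cyclomatic number at most two is a cycle, two cycles sharing a vertex,
or a theta graph. Here a pivot $u$ is chosen whose deletion leaves a forest $F$. Sets containing $u$
number $\binom{|F|}{k}$, so the cop-win sets avoiding $u$ must be paid for by bad sets containing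
$u$. A connected $S\subseteq F$ with a cut vertex $x$ such that $u$ does not reconnect $S-x$ pays
with $u\cup(S-x)$; this is injective because in a forest at most one vertex reconnects a given
disconnected set (`copCount_add_card_le`). The remaining, resistant, sets have minimum degree two
together with $u$, so they are cycles through $u$ with $u$ deleted, or all of $F$. They are counted
directly or assigned bad sets of another kind (`copCount_le_choose_of_replacement`).

Theta graphs missing only one or two vertices need separate counts, in which triangle-free sets with
a cycle are bad. There the bound can fail by one at order $6$, $k=3$, and the induction carries this
exception. -/

namespace CopWin

set_option linter.unusedSectionVars false

variable {V : Type*} [DecidableEq V] (G : SimpleGraph V)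

open Classical in
/-- The number of neighbours of `v` in `A`. -/
noncomputable def deg (A : Finset V) (v : V) : ℕ := (A.filter (G.Adj v)).card

/-- The sum of the degrees of the subgraph induced by `S`, that is, twice its number of edges. -/
noncomputable def degSum (S : Finset V) : ℕ := ∑ v ∈ S, deg G S v

/-- The subgraph induced by `S` has no separation (the empty set counts as connected). -/
def Conn (S : Finset V) : Prop :=
  ∀ P : V → Prop, (∃ a ∈ S, P a) → (∃ b ∈ S, ¬ P b) → ∃ a ∈ S, ∃ b ∈ S, P a ∧ ¬ P b ∧ G.Adj a b

/-- `S` induces a cop-win subgraph. -/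
def Good (S : Finset V) : Prop := IsCopWin (G.induce (S : Set V))

open Classical in
/-- The number of `i`-element subsets of `X` which induce a cop-win subgraph. -/
noncomputable def copCount (X : Finset V) (i : ℕ) : ℕ := ((X.powersetCard i).filter (Good G)).card

variable {G}

/-! ### Degrees and edge counts of induced subgraphs -/

section Degrees

lemma deg_mono {A B : Finset V} (h : A ⊆ B) (v : V) : deg G A v ≤ deg G B v := by
  classical exact Finset.card_le_card (Finset.filter_subset_filter _ h)

lemma deg_le_card (A : Finset V) (v : V) : deg G A v ≤ A.card := by
  classical exact Finset.card_filter_le _ _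

lemma deg_add_deg_sdiff {A X : Finset V} (h : A ⊆ X) (v : V) :
    deg G A v + deg G (X \ A) v = deg G X v := by
  classical
  unfold deg
  rw [← Finset.card_union_of_disjoint, ← Finset.filter_union, Finset.union_sdiff_of_subset h]
  exact Finset.disjoint_filter_filter Finset.disjoint_sdiff

open Classical in
lemma deg_insert {A : Finset V} {x : V} (hx : x ∉ A) (v : V) :
    deg G (insert x A) v = deg G A v + if G.Adj v x then 1 else 0 := by
  unfold deg
  rw [Finset.filter_insert]
  split_ifs with h
  · rw [Finset.card_insert_of_notMem (by simp [hx])]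
  · rfl

lemma deg_insert_self (A : Finset V) (v : V) : deg G (insert v A) v = deg G A v := by
  unfold deg
  rw [Finset.filter_insert, if_neg (G.loopless.irrefl v)]

lemma deg_erase_self (A : Finset V) (v : V) : deg G (A.erase v) v = deg G A v := by
  by_cases hv : v ∈ A
  · rw [← deg_insert_self (A.erase v), Finset.insert_erase hv]
  · rw [Finset.erase_eq_of_notMem hv]

lemma deg_pos_iff {A : Finset V} {v : V} : 0 < deg G A v ↔ ∃ x ∈ A, G.Adj v x := by
  unfold deg
  rw [Finset.card_pos]
  simp [Finset.Nonempty]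

lemma two_le_deg_iff {A : Finset V} {v : V} :
    2 ≤ deg G A v ↔ ∃ x ∈ A, ∃ y ∈ A, x ≠ y ∧ G.Adj v x ∧ G.Adj v y := by
  unfold deg
  rw [← Nat.lt_iff_add_one_le, Finset.one_lt_card]
  simp only [Finset.mem_filter]
  constructor
  · rintro ⟨a, ⟨h1, h2⟩, b, ⟨h3, h4⟩, h⟩; exact ⟨a, h1, b, h3, h, h2, h4⟩
  · rintro ⟨a, h1, b, h3, h, h2, h4⟩; exact ⟨a, ⟨h1, h2⟩, b, ⟨h3, h4⟩, h⟩

lemma three_le_deg {A : Finset V} {v x y z : V} (hx : x ∈ A) (hy : y ∈ A) (hz : z ∈ A)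
    (hxy : x ≠ y) (hxz : x ≠ z) (hyz : y ≠ z) (h1 : G.Adj v x) (h2 : G.Adj v y)
    (h3 : G.Adj v z) : 3 ≤ deg G A v := by
  have : ({x, y, z} : Finset V).card = 3 := Finset.card_eq_three.2 ⟨x, y, z, hxy, hxz, hyz, rfl⟩
  rw [← this]
  apply Finset.card_le_card
  intro t ht
  simp only [Finset.mem_insert, Finset.mem_singleton] at ht
  rcases ht with rfl | rfl | rfl <;> simp [*]

lemma exists_pair_of_deg_eq_two {A : Finset V} {v : V} (h : deg G A v = 2) :
    ∃ x ∈ A, ∃ y ∈ A, x ≠ y ∧ G.Adj v x ∧ G.Adj v y ∧ ∀ t ∈ A, G.Adj v t → t = x ∨ t = y := by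
  obtain ⟨x, hx, y, hy, hxy, h1, h2⟩ := two_le_deg_iff.1 h.ge
  refine ⟨x, hx, y, hy, hxy, h1, h2, fun t ht h3 => ?_⟩
  by_contra! hne
  have := three_le_deg hx hy ht hxy hne.1.symm hne.2.symm h1 h2 h3
  omega

lemma eq_of_deg_le_one {A : Finset V} {v x y : V} (h : deg G A v ≤ 1) (hx : x ∈ A) (hy : y ∈ A)
    (h1 : G.Adj v x) (h2 : G.Adj v y) : x = y := by
  by_contra hne
  have := two_le_deg_iff.2 ⟨x, hx, y, hy, hne, h1, h2⟩
  omega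

lemma deg_comm_sum (A B : Finset V) : ∑ a ∈ A, deg G B a = ∑ b ∈ B, deg G A b := by
  classical
  simp only [deg, Finset.card_filter]
  rw [Finset.sum_comm]
  simp only [G.adj_comm]

lemma degSum_split {A X : Finset V} (h : A ⊆ X) :
    degSum G X = degSum G A + degSum G (X \ A) + 2 * ∑ a ∈ A, deg G (X \ A) a := by
  have h1 : degSum G X = ∑ a ∈ A, deg G X a + ∑ a ∈ X \ A, deg G X a := by
    unfold degSum
    rw [add_comm, Finset.sum_sdiff h]
  rw [h1]
  simp only [← deg_add_deg_sdiff h, Finset.sum_add_distrib]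
  rw [deg_comm_sum (X \ A) A]
  unfold degSum
  ring

lemma degSum_erase {S : Finset V} {v : V} (hv : v ∈ S) :
    degSum G S = degSum G (S.erase v) + 2 * deg G S v := by
  have h := degSum_split (G := G) (A := {v}) (X := S) (by simpa using hv)
  rw [Finset.sdiff_singleton_eq_erase, Finset.sum_singleton, deg_erase_self] at h
  have : degSum G {v} = 0 := by
    simp [degSum, deg]
  omega

lemma degSum_insert {S : Finset V} {v : V} (hv : v ∉ S) :
    degSum G (insert v S) = degSum G S + 2 * deg G S v := by
  rw [degSum_erase (Finset.mem_insert_self v S), Finset.erase_insert hv, deg_insert_self]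

lemma even_degSum (S : Finset V) : Even (degSum G S) := by
  induction S using Finset.induction_on with
  | empty => simp [degSum]
  | insert v S hv ih => rw [degSum_insert hv]; exact ih.add (even_two_mul _)

lemma degSum_mono {A X : Finset V} (h : A ⊆ X) : degSum G A ≤ degSum G X := by
  have := degSum_split (G := G) h
  omega

/-- A set inducing at least as many edges as vertices contains a set of minimum degree two. -/
lemma exists_core {S : Finset V} (hS : S.Nonempty) (h : 2 * S.card ≤ degSum G S) :
    ∃ D ⊆ S, D.Nonempty ∧ ∀ v ∈ D, 2 ≤ deg G D v := by
  induction S using Finset.strongInduction with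
  | H S ih =>
    by_cases hc : ∀ v ∈ S, 2 ≤ deg G S v
    · exact ⟨S, subset_rfl, hS, hc⟩
    · push Not at hc
      obtain ⟨v, hv, hd⟩ := hc
      have h1 := degSum_erase (G := G) hv
      have h2 := Finset.card_erase_of_mem hv
      have h3 := Finset.card_pos.2 hS
      -- A single vertex has degree sum zero, so the deletion process stops before the set becomes
      -- empty.
      have hne : (S.erase v).Nonempty := by
        by_contra hem
        rw [Finset.not_nonempty_iff_eq_empty] at hem
        have h4 : deg G S v = 0 := by
          rw [← deg_erase_self, hem]; simp [deg]
        rw [hem] at h1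
        have h5 : degSum G (∅ : Finset V) = 0 := by simp [degSum]
        omega
      obtain ⟨D, hD, h⟩ := ih _ (Finset.erase_ssubset hv) hne (by omega)
      exact ⟨D, hD.trans (Finset.erase_subset _ _), h⟩

end Degrees

/-! ### Connected sets -/

section Connectivity

lemma Conn.exists_adj {S : Finset V} (h : Conn G S) {s t : V} (hs : s ∈ S) (ht : t ∈ S)
    (hst : t ≠ s) : ∃ y ∈ S, G.Adj s y := by
  obtain ⟨a, ha, b, hb, rfl, -, hab⟩ := h (· = s) ⟨s, hs, rfl⟩ ⟨t, ht, hst⟩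
  exact ⟨b, hb, hab⟩

lemma Conn.deg_pos {S : Finset V} (h : Conn G S) {s : V} (hs : s ∈ S) (h2 : 2 ≤ S.card) :
    0 < deg G S s := by
  obtain ⟨t, ht, hne⟩ := Finset.exists_mem_ne (Nat.lt_of_succ_le h2) s
  exact deg_pos_iff.2 (h.exists_adj hs ht hne)

/-- Growing a subset from one vertex, connectivity always offers a new vertex with a neighbour in
the part already built, so each step adds an edge. -/
lemma Conn.two_mul_card_le {S : Finset V} (h : Conn G S) (hS : S.Nonempty) :
    2 * S.card ≤ degSum G S + 2 := by
  have key : ∀ k, 1 ≤ k → k ≤ S.card → ∃ T ⊆ S, T.card = k ∧ 2 * k ≤ degSum G T + 2 := by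
    intro k hk
    induction k, hk using Nat.le_induction with
    | base =>
      intro _
      obtain ⟨s, hs⟩ := hS
      exact ⟨{s}, by simpa using hs, by simp, by omega⟩
    | succ k hk ih =>
      intro hkS
      obtain ⟨T, hT, hc, hd⟩ := ih (by omega)
      obtain ⟨t, ht⟩ := Finset.card_pos.1 (by omega : 0 < T.card)
      obtain ⟨b, hb, hbT⟩ := Finset.exists_mem_notMem_of_card_lt_card (by omega : T.card < S.card)
      obtain ⟨x, hx, y, hy, hxT, hyT, hxy⟩ := h (· ∈ T) ⟨t, hT ht, ht⟩ ⟨b, hb, hbT⟩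
      refine ⟨insert y T, Finset.insert_subset hy hT, by simp [hyT, hc], ?_⟩
      have := degSum_insert (G := G) hyT
      have : 0 < deg G T y := deg_pos_iff.2 ⟨x, hxT, hxy.symm⟩
      omega
  obtain ⟨T, hT, hc, hd⟩ := key S.card (Finset.card_pos.2 hS) le_rfl
  rwa [Finset.eq_of_subset_of_card_le hT hc.ge] at hd

lemma conn_of_connected [Fintype V] (h : G.Connected) : Conn G Finset.univ := by
  rintro P ⟨a, -, ha⟩ ⟨b, -, hb⟩
  obtain ⟨p⟩ := h.preconnected a b
  obtain ⟨d, -, h1, h2⟩ := p.exists_boundary_dart {x | P x} ha hb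
  exact ⟨d.fst, Finset.mem_univ _, d.snd, Finset.mem_univ _, h1, h2, d.adj⟩

/-- The cop never leaves a union of components, and the robber may always stay put, so only a robber
inside it can be caught. -/
lemma copWinsFrom_closed {H : SimpleGraph V} {c r : V} (h : CopWinsFrom H c r) {P : V → Prop}
    (hP : ∀ a b, P a → H.Adj a b → P b) (hc : P c) : P r := by
  induction h with
  | capture c r h =>
    rcases h with rfl | h
    · exact hc
    · exact hP _ _ hc h
  | move c c' r hcc _ ih =>
    refine ih r (Or.inl rfl) ?_
    rcases hcc with rfl | h
    · exact hc
    · exact hP _ _ hc h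

end Connectivity

/-! ### Criteria for cop-win and non-cop-win sets -/

lemma Good.nonempty {S : Finset V} (h : Good G S) : S.Nonempty := by
  obtain ⟨c, -⟩ := h
  exact ⟨c.1, c.2⟩

lemma Good.conn {S : Finset V} (h : Good G S) : Conn G S := by
  obtain ⟨c, hc⟩ := h
  rintro P ⟨a, ha, hPa⟩ ⟨b, hb, hPb⟩
  by_contra! hcon
  by_cases hPc : P c.1
  · refine hPb (copWinsFrom_closed (hc ⟨b, hb⟩) (P := fun x => P x.1) ?_ hPc)
    rintro ⟨x, hx⟩ ⟨y, hy⟩ h1 h2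
    by_contra h3
    exact hcon x hx y hy h1 h3 h2
  · refine copWinsFrom_closed (hc ⟨a, ha⟩) (P := fun x => ¬ P x.1) ?_ hPc hPa
    rintro ⟨x, hx⟩ ⟨y, hy⟩ h1 h2 h3
    exact hcon y hy x hx h3 h1 h2.symm

/-- A robber who stays in a set in which nobody is dominated is never caught. -/
lemma not_copWinsFrom_of_escape {H : SimpleGraph V} {D : Set V}
    (hD : ∀ r ∈ D, ∀ c, c ≠ r → ∃ r' ∈ D, (r' = r ∨ H.Adj r r') ∧ r' ≠ c ∧ ¬ H.Adj c r')
    {c r : V} (h : CopWinsFrom H c r) : r ∈ D → c ≠ r → ¬ H.Adj c r → False := by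
  induction h with
  | capture c r h =>
    intro _ h1 h2
    exact h.elim h1 h2
  | move c c' r hcc _ ih =>
    intro hr h1 h2
    have hne : c' ≠ r := by
      rcases hcc with rfl | h
      · exact h1
      · rintro rfl; exact h2 h
    obtain ⟨r', hr', hm, h3, h4⟩ := hD r hr c' hne
    exact ih r' hm hr' h3.symm h4

/-- A triangle-free graph containing a cycle is not cop-win. -/
lemma not_good_of_core {S D : Finset V} (hDS : D ⊆ S) (hne : D.Nonempty)
    (hdeg : ∀ v ∈ D, 2 ≤ deg G D v)
    (htri : ∀ x ∈ S, ∀ y ∈ S, ∀ z ∈ S, G.Adj x y → G.Adj y z → ¬ G.Adj x z) : ¬ Good G S := by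
  rintro ⟨c, hc⟩
  have hD : ∀ r ∈ {x : (S : Set V) | x.1 ∈ D}, ∀ c, c ≠ r → ∃ r' ∈ {x : (S : Set V) | x.1 ∈ D},
      (r' = r ∨ (G.induce (S : Set V)).Adj r r') ∧ r' ≠ c ∧
        ¬ (G.induce (S : Set V)).Adj c r' := by
    rintro ⟨r, hrS⟩ hr ⟨c, hcS⟩ hcr
    have hcr' : c ≠ r := fun h => hcr (Subtype.ext h)
    by_cases hadj : G.Adj c r
    · obtain ⟨x, hx, y, hy, hxy, h1, h2⟩ := two_le_deg_iff.1 (hdeg r hr)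
      -- A cop adjacent to `r` cannot also be adjacent to a neighbour `t` of `r` without forming a
      -- triangle. Of the two neighbours of `r` in `D`, at least one differs from `c`, so it is a
      -- safe reply.
      have key : ∀ t ∈ D, G.Adj r t → t ≠ c → ∃ r' ∈ {x : (S : Set V) | x.1 ∈ D},
          (r' = ⟨r, hrS⟩ ∨ (G.induce (S : Set V)).Adj ⟨r, hrS⟩ r') ∧ r' ≠ ⟨c, hcS⟩ ∧
            ¬ (G.induce (S : Set V)).Adj ⟨c, hcS⟩ r' := by
        intro t ht h3 h4
        refine ⟨⟨t, hDS ht⟩, ht, Or.inr h3, fun h => h4 (congrArg Subtype.val h), fun h => ?_⟩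
        exact htri c hcS r hrS t (hDS ht) hadj h3 h
      by_cases hxc : x = c
      · exact key y hy h2 (fun h => hxy (hxc.trans h.symm))
      · exact key x hx h1 hxc
    · exact ⟨⟨r, hrS⟩, hr, Or.inl rfl, hcr.symm, hadj⟩
  have start : ∃ r : (S : Set V), r.1 ∈ D ∧ c ≠ r ∧ ¬ (G.induce (S : Set V)).Adj c r := by
    obtain ⟨d, hd⟩ := hne
    obtain ⟨x, hx, -⟩ := two_le_deg_iff.1 (hdeg d hd)
    obtain ⟨y, hy, -, -, -, h2, -⟩ := two_le_deg_iff.1 (hdeg d hd)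
    obtain ⟨r₀, hr₀, hne⟩ : ∃ r₀ ∈ D, c.1 ≠ r₀ := by
      by_cases h : c.1 = d
      · exact ⟨y, hy, fun h' => h2.ne (h.symm.trans h')⟩
      · exact ⟨d, hd, h⟩
    obtain ⟨r, hr, -, h3, h4⟩ := hD ⟨r₀, hDS hr₀⟩ hr₀ c (fun h => hne (congrArg Subtype.val h))
    exact ⟨r, hr, h3.symm, h4⟩
  obtain ⟨r, hr, h1, h2⟩ := start
  exact not_copWinsFrom_of_escape hD (hc r) hr h1 h2

lemma not_good_of_triangleFree {S : Finset V} (hne : S.Nonempty) (h : 2 * S.card ≤ degSum G S)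
    (htri : ∀ x ∈ S, ∀ y ∈ S, ∀ z ∈ S, G.Adj x y → G.Adj y z → ¬ G.Adj x z) : ¬ Good G S := by
  obtain ⟨D, hDS, hD, hdeg⟩ := exists_core hne h
  exact not_good_of_core hDS hD hdeg htri

/-- The cop starts at the dominating vertex and captures on the first move. -/
lemma good_of_dominating {S : Finset V} {c : V} (hc : c ∈ S)
    (h : ∀ x ∈ S, c = x ∨ G.Adj c x) : Good G S :=
  ⟨⟨c, hc⟩, fun r => .capture _ _ ((h r.1 r.2).imp (fun h => Subtype.ext h) id)⟩

variable (G) in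
/-- Every nonempty subset of `F` induces fewer edges than vertices. -/
def Forest (F : Finset V) : Prop := ∀ S ⊆ F, S.Nonempty → degSum G S < 2 * S.card

variable (G) in
/-- Every nonempty proper subset of `X` has at least two boundary edges in `X`. -/
def Bridgeless (X : Finset V) : Prop :=
  ∀ A ⊆ X, A.Nonempty → A ≠ X → 2 ≤ ∑ a ∈ A, deg G (X \ A) a

/-! ### Forests: at most one vertex reconnects a disconnected set -/

section Forest

/-- Two edges into a connected set would close a cycle. -/
lemma Forest.deg_le_one {F T : Finset V} (hF : Forest G F) (hTF : T ⊆ F) (hT : Conn G T) {y : V}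
    (hy : y ∈ F) (hyT : y ∉ T) : deg G T y ≤ 1 := by
  by_contra! h
  obtain ⟨t, ht, -⟩ := two_le_deg_iff.1 h
  have h1 := hT.two_mul_card_le ⟨t, ht⟩
  have h2 := hF (insert y T) (Finset.insert_subset hy hTF) ⟨y, Finset.mem_insert_self _ _⟩
  rw [degSum_insert hyT, Finset.card_insert_of_notMem hyT] at h2
  omega

/-- The new vertex needs a neighbour on each side of a separation of `K`. -/
lemma two_le_deg_of_connects {K : Finset V} (hK : ¬ Conn G K) {y : V} (hy : y ∉ K)
    (h : Conn G (insert y K)) : 2 ≤ deg G K y := by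
  unfold Conn at hK
  push Not at hK
  obtain ⟨P, ⟨a, ha, hPa⟩, ⟨b, hb, hPb⟩, hno⟩ := hK
  have h1 : ∃ x ∈ K, P x ∧ G.Adj y x := by
    obtain ⟨s, hs, t, ht, h1, h2, h3⟩ := h (fun t => t ∈ K ∧ P t)
      ⟨a, Finset.mem_insert_of_mem ha, ha, hPa⟩ ⟨y, Finset.mem_insert_self _ _, fun h => hy h.1⟩
    rcases Finset.mem_insert.1 ht with rfl | ht
    · exact ⟨s, h1.1, h1.2, h3.symm⟩
    · exact absurd h3 (hno s h1.1 t ht h1.2 fun h => h2 ⟨ht, h⟩)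
  have h2 : ∃ x ∈ K, ¬ P x ∧ G.Adj y x := by
    obtain ⟨s, hs, t, ht, g1, g2, g3⟩ := h (fun t => t ∈ K ∧ ¬ P t)
      ⟨b, Finset.mem_insert_of_mem hb, hb, hPb⟩ ⟨y, Finset.mem_insert_self _ _, fun h => hy h.1⟩
    rcases Finset.mem_insert.1 ht with rfl | ht
    · exact ⟨s, g1.1, g1.2, g3.symm⟩
    · refine absurd g3.symm (hno t ht s g1.1 ?_ g1.2)
      by_contra h
      exact g2 ⟨ht, h⟩
  obtain ⟨x, hx, hPx, hyx⟩ := h1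
  obtain ⟨z, hz, hPz, hyz⟩ := h2
  exact two_le_deg_iff.2 ⟨x, hx, z, hz, fun h => hPz (h ▸ hPx), hyx, hyz⟩

/-- A second connector would have two neighbours in the connected set `insert x K`, closing a cycle.
This makes the removal of a cut vertex an injective operation. -/
lemma Forest.connector_unique {F K : Finset V} (hF : Forest G F) (hKF : K ⊆ F) (hK : ¬ Conn G K)
    {x y : V} (hx : x ∈ F) (hy : y ∈ F) (hyK : y ∉ K) (h1 : Conn G (insert x K))
    (h2 : Conn G (insert y K)) : x = y := by
  by_contra hne
  have h3 := two_le_deg_of_connects hK hyK h2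
  have h4 := hF.deg_le_one (Finset.insert_subset hx hKF) h1 hy (by simp [hyK, Ne.symm hne])
  have := deg_mono (G := G) (Finset.subset_insert x K) y
  omega

end Forest

/-! ### The pivot argument: paying for sets avoiding `u` with bad sets containing `u` -/

section Pivot

open Classical in
lemma copCount_insert {F : Finset V} {u : V} (hu : u ∉ F) (k : ℕ) :
    copCount G (insert u F) (k + 1) = copCount G F (k + 1) +
      ((F.powersetCard k).filter fun T => Good G (insert u T)).card := by
  unfold copCount
  have e : (insert u F).powersetCard (k + 1) =
      F.powersetCard (k + 1) ∪ (F.powersetCard k).image (insert u) := by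
    convert Finset.powersetCard_succ_insert hu k
  rw [e, Finset.filter_union, Finset.card_union_of_disjoint, Finset.filter_image,
    Finset.card_image_of_injOn]
  · intro S hS T hT h
    simp only [Finset.coe_filter, Finset.mem_powersetCard, Set.mem_ofPred_eq] at hS hT
    have h1 : u ∉ S := fun h => hu (hS.1.1 h)
    have h2 : u ∉ T := fun h => hu (hT.1.1 h)
    have := congrArg (fun A => Finset.erase A u) h
    simpa [h1, h2] using this
  · rw [Finset.disjoint_left]
    intro S hS hS'
    simp only [Finset.mem_filter, Finset.mem_powersetCard, Finset.mem_image] at hS hS'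
    obtain ⟨⟨T, -, rfl⟩, -⟩ := hS'
    exact hu (hS.1.1 (Finset.mem_insert_self _ _))

open Classical in
lemma card_good_add_card_bad (F : Finset V) (u : V) (k : ℕ) :
    ((F.powersetCard k).filter fun T => Good G (insert u T)).card +
      ((F.powersetCard k).filter fun T => ¬ Good G (insert u T)).card = F.card.choose k := by
  rw [Finset.card_filter_add_card_filter_not, Finset.card_powersetCard]

open Classical in
variable (G) in
/-- The connected `i`-subsets `S` of `F` such that `u` reconnects `S` whenever the deletion of a
vertex of `S` disconnects it. -/
noncomputable def resistant (F : Finset V) (u : V) (i : ℕ) : Finset (Finset V) :=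
  (F.powersetCard i).filter fun S =>
    Conn G S ∧ ∀ x ∈ S, ¬ Conn G (S.erase x) → Conn G (insert u (S.erase x))

lemma mem_resistant {F S : Finset V} {u : V} {i : ℕ} : S ∈ resistant G F u i ↔
    (S ⊆ F ∧ S.card = i) ∧ Conn G S ∧
      ∀ x ∈ S, ¬ Conn G (S.erase x) → Conn G (insert u (S.erase x)) := by
  classical
  simp [resistant]

/-- Replacing a cut vertex by `u` injects the non-resistant connected sets avoiding `u` into the
sets containing `u` which are not cop-win. -/
lemma copCount_add_card_le {F : Finset V} {u : V} (hu : u ∉ F) (hF : Forest G F) {k : ℕ}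
    (R : Finset (Finset V)) (hRF : ∀ T ∈ R, T ⊆ F ∧ T.card = k)
    (hRbad : ∀ T ∈ R, ¬ Good G (insert u T))
    (hR : ∀ T ∈ R, ∀ x ∈ F, x ∉ T → Conn G (insert x T) → Conn G T) :
    copCount G (insert u F) (k + 1) + R.card ≤
      F.card.choose k + (resistant G F u (k + 1)).card := by
  classical
  have h1 := copCount_insert (G := G) hu k
  have h2 := card_good_add_card_bad (G := G) F u k
  set N := (F.powersetCard (k + 1)).filter fun S => Conn G S ∧
    ¬ ∀ x ∈ S, ¬ Conn G (S.erase x) → Conn G (insert u (S.erase x)) with hN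
  have h3 : copCount G F (k + 1) ≤ (resistant G F u (k + 1)).card + N.card := by
    unfold copCount
    refine le_trans (Finset.card_le_card ?_) (Finset.card_union_le _ _)
    intro S hS
    simp only [Finset.mem_filter, Finset.mem_powersetCard] at hS
    rw [Finset.mem_union, mem_resistant, hN, Finset.mem_filter, Finset.mem_powersetCard]
    by_cases h : ∀ x ∈ S, ¬ Conn G (S.erase x) → Conn G (insert u (S.erase x))
    · exact Or.inl ⟨hS.1, hS.2.conn, h⟩
    · exact Or.inr ⟨hS.1, hS.2.conn, h⟩
  have h4 : ∀ S ∈ N, ∃ x ∈ S, ¬ Conn G (S.erase x) ∧ ¬ Conn G (insert u (S.erase x)) := by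
    intro S hS
    have := (Finset.mem_filter.1 hS).2.2
    push Not at this
    exact this
  have : Nonempty V := ⟨u⟩
  choose! f hfS hf1 hf2 using h4
  have hsub : ∀ S ∈ N, S ⊆ F ∧ S.card = k + 1 ∧ Conn G S := by
    intro S hS
    have := Finset.mem_filter.1 hS
    exact ⟨(Finset.mem_powersetCard.1 this.1).1, (Finset.mem_powersetCard.1 this.1).2, this.2.1⟩
  have hinj : Set.InjOn (fun S : Finset V => S.erase (f S)) (N : Set (Finset V)) := by
    intro S hS T hT h
    simp only [Finset.mem_coe] at hS hT h
    have e : f S = f T := by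
      refine hF.connector_unique (K := S.erase (f S)) ((Finset.erase_subset _ _).trans
        (hsub S hS).1) (hf1 S hS) ((hsub S hS).1 (hfS S hS))
        ((hsub T hT).1 (hfS T hT)) (by rw [h]; exact Finset.notMem_erase _ _) ?_ ?_
      · rw [Finset.insert_erase (hfS S hS)]; exact (hsub S hS).2.2
      · rw [h, Finset.insert_erase (hfS T hT)]; exact (hsub T hT).2.2
    rw [← Finset.insert_erase (hfS S hS), h, e, Finset.insert_erase (hfS T hT)]
  -- The images of `N` become connected when the deleted cut vertex is put back, and `hR` forbids
  -- this for the disconnected sets in `R`; so the two families of bad sets are disjoint.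
  have h5 : N.card + R.card ≤
      ((F.powersetCard k).filter fun T => ¬ Good G (insert u T)).card := by
    rw [← Finset.card_image_of_injOn hinj, ← Finset.card_union_of_disjoint]
    · apply Finset.card_le_card
      intro T hT
      rw [Finset.mem_union, Finset.mem_image] at hT
      rw [Finset.mem_filter, Finset.mem_powersetCard]
      rcases hT with ⟨S, hS, rfl⟩ | hT
      · refine ⟨⟨(Finset.erase_subset _ _).trans (hsub S hS).1, ?_⟩, fun h => hf2 S hS h.conn⟩
        rw [Finset.card_erase_of_mem (hfS S hS), (hsub S hS).2.1]; rfl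
      · exact ⟨hRF T hT, hRbad T hT⟩
    · rw [Finset.disjoint_left]
      intro T hT hTR
      obtain ⟨S, hS, rfl⟩ := Finset.mem_image.1 hT
      refine hf1 S hS (hR _ hTR (f S) ((hsub S hS).1 (hfS S hS)) (Finset.notMem_erase _ _) ?_)
      rw [Finset.insert_erase (hfS S hS)]; exact (hsub S hS).2.2
  omega

/-- A resistant set together with the pivot has minimum degree two. -/
lemma two_le_deg_of_mem_resistant {F S : Finset V} {u : V} {i : ℕ} (hu : u ∉ F)
    (hF : Forest G F) (hi : 3 ≤ i) (hS : S ∈ resistant G F u i) :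
    ∀ v ∈ insert u S, 2 ≤ deg G (insert u S) v := by
  classical
  obtain ⟨⟨hSF, hcard⟩, hconn, hres⟩ := mem_resistant.1 hS
  have huS : u ∉ S := fun h => hu (hSF h)
  have hpos : ∀ s ∈ S, 0 < deg G S s := fun s hs => hconn.deg_pos hs (by omega)
  -- Deleting the only neighbour of a leaf isolates the leaf, so resistance forces `u` to be
  -- adjacent to it. The bound `3 ≤ i` ensures that another vertex remains.
  have hleaf : ∀ s ∈ S, deg G S s ≤ 1 → G.Adj u s := by
    intro s hs hd
    obtain ⟨x, hx, hsx⟩ := deg_pos_iff.1 (hpos s hs)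
    have hsx' : s ∈ S.erase x := Finset.mem_erase.2 ⟨hsx.ne, hs⟩
    have hiso : ∀ y ∈ S.erase x, ¬ G.Adj s y := by
      intro y hy hsy
      exact (Finset.mem_erase.1 hy).1
        (eq_of_deg_le_one hd (Finset.mem_of_mem_erase hy) hx hsy hsx)
    have h1 : ¬ Conn G (S.erase x) := by
      intro h
      have := h.deg_pos hsx' (by rw [Finset.card_erase_of_mem hx]; omega)
      obtain ⟨y, hy, hsy⟩ := deg_pos_iff.1 this
      exact hiso y hy hsy
    obtain ⟨y, hy, hsy⟩ := (hres x hx h1).exists_adj (Finset.mem_insert_of_mem hsx')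
      (Finset.mem_insert_self _ _) (fun h => huS (h ▸ hs))
    rcases Finset.mem_insert.1 hy with rfl | hy
    · exact hsy.symm
    · exact absurd hsy (hiso y hy)
  intro v hv
  rcases Finset.mem_insert.1 hv with rfl | hv
  · rw [deg_insert_self]
    have hne : S.Nonempty := Finset.card_pos.1 (by omega)
    have h1 := hF S hSF hne
    -- This shows that the tree `S` has at least two leaves: its degree sum is even and below `2 *
    -- S.card`, so it falls short by at least two. All leaves are neighbours of the pivot.
    have h2 : (∑ s ∈ S, 2) ≤ ∑ s ∈ S, (deg G S s + if deg G S s ≤ 1 then 1 else 0) := by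
      apply Finset.sum_le_sum
      intro s hs
      have := hpos s hs
      split_ifs <;> omega
    rw [Finset.sum_add_distrib, Finset.sum_const, smul_eq_mul, ← Finset.card_filter] at h2
    have h3 : (S.filter fun s => deg G S s ≤ 1).card ≤ deg G S v := by
      unfold deg
      apply Finset.card_le_card
      intro s hs
      rw [Finset.mem_filter] at hs ⊢
      exact ⟨hs.1, hleaf s hs.1 hs.2⟩
    have h4 := even_degSum (G := G) S
    unfold degSum at h1 h4
    obtain ⟨m, hm⟩ := h4
    omega
  · rw [deg_insert huS]
    have := hpos v hv
    split_ifs with h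
    · omega
    · by_contra hcon
      exact h (hleaf v hv (by omega)).symm

end Pivot

/-! ### Bridgeless sets: one cycle, or two cycles sharing a vertex -/

section Bridgeless

lemma Bridgeless.two_le_deg {X : Finset V} (hX : Bridgeless G X) (h2 : 2 ≤ X.card) {v : V}
    (hv : v ∈ X) : 2 ≤ deg G X v := by
  have := hX {v} (by simpa using hv) ⟨v, by simp⟩ (by rintro rfl; simp at h2)
  rwa [Finset.sum_singleton, Finset.sdiff_singleton_eq_erase, deg_erase_self] at this

/-- Hypotheses shared by the arguments below: `X` is bridgeless and the vertices other than `u` and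
`w` have degree two. -/
structure Theta (G : SimpleGraph V) (X : Finset V) (u w : V) : Prop where
  bridgeless : Bridgeless G X
  mem : u ∈ X
  deg_eq : ∀ v ∈ X, v ≠ u → v ≠ w → deg G X v = 2
  deg_le : w ≠ u → deg G X w ≤ 3

variable {X : Finset V} {u w : V}

/-- In a subset of minimum degree two avoiding `u`, the only boundary edge leaves from `w`. -/
lemma Theta.eq_of_core (h : Theta G X u w) {D : Finset V} (hD : D ⊆ X) (hne : D.Nonempty)
    (hdeg : ∀ v ∈ D, 2 ≤ deg G D v) : u ∈ D := by
  by_contra hu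
  have h1 := h.bridgeless D hD hne (by rintro rfl; exact hu h.mem)
  have h2 : ∑ a ∈ D, deg G (X \ D) a ≤ ∑ a ∈ D, if a = w then 1 else 0 := by
    apply Finset.sum_le_sum
    intro a ha
    have e := deg_add_deg_sdiff (G := G) hD a
    have := hdeg a ha
    have hau : a ≠ u := fun h => hu (h ▸ ha)
    split_ifs with haw
    · subst haw
      have := h.deg_le hau
      omega
    · have := h.deg_eq a (hD ha) hau haw
      omega
  rw [Finset.sum_ite_eq'] at h2
  split_ifs at h2 <;> omega

/-- A subset with as many edges as vertices would contain a core, and every core contains `u`. -/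
lemma Theta.forest (h : Theta G X u w) : Forest G (X.erase u) := by
  intro S hS hne
  by_contra! hcon
  obtain ⟨D, hDS, hD, hdeg⟩ := exists_core hne hcon
  have := h.eq_of_core ((hDS.trans hS).trans (Finset.erase_subset _ _)) hD hdeg
  exact Finset.notMem_erase u X (hS (hDS this))

end Bridgeless

variable {X : Finset V} {u w : V}

lemma copCount_eq_zero {i : ℕ} (h : X.card < i) : copCount G X i = 0 := by
  classical
  unfold copCount
  rw [Finset.powersetCard_eq_empty.2 h]; simp

lemma copCount_card_le : copCount G X X.card ≤ 1 := by
  classical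
  unfold copCount
  refine (Finset.card_filter_le _ _).trans ?_
  simp

lemma copCount_le_choose_of_card_le {k : ℕ} (h : X.card ≤ k + 1) :
    copCount G X (k + 1) ≤ (X.card - 1).choose k := by
  rcases h.lt_or_eq with h | h
  · rw [copCount_eq_zero h]; exact Nat.zero_le _
  · rw [← h]
    refine copCount_card_le.trans ?_
    rw [h]; simp

/-- If every resistant set can be replaced by its own set of another kind, the number of cop-win
sets is at most that of a star. -/
lemma copCount_le_choose_of_replacement {F : Finset V} (hu : u ∉ F) (hF : Forest G F) {k : ℕ}
    (tag : Finset V → Finset V → Prop)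
    (hex : ∀ S ∈ resistant G F u (k + 1), ∃ T, (T ⊆ F ∧ T.card = k) ∧ ¬ Good G (insert u T) ∧
      (∀ x ∈ F, x ∉ T → Conn G (insert x T) → Conn G T) ∧ tag S T)
    (htag : ∀ S₁ ∈ resistant G F u (k + 1), ∀ S₂ ∈ resistant G F u (k + 1), ∀ T,
      tag S₁ T → tag S₂ T → S₁ = S₂) :
    copCount G (insert u F) (k + 1) ≤ F.card.choose k := by
  classical
  choose! f h1 h2 h3 h4 using hex
  have hinj : Set.InjOn f (resistant G F u (k + 1) : Set (Finset V)) := by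
    intro S hS T hT h
    exact htag S hS T hT (f S) (h4 S hS) (h ▸ h4 T hT)
  have := copCount_add_card_le hu hF (k := k) ((resistant G F u (k + 1)).image f)
    (by intro T hT; obtain ⟨S, hS, rfl⟩ := Finset.mem_image.1 hT; exact h1 S hS)
    (by intro T hT; obtain ⟨S, hS, rfl⟩ := Finset.mem_image.1 hT; exact h2 S hS)
    (by intro T hT; obtain ⟨S, hS, rfl⟩ := Finset.mem_image.1 hT; exact h3 S hS)
  rw [Finset.card_image_of_injOn hinj] at this
  omega

lemma card_insert_erase_erase {S : Finset V} {p q z : V} (hp : p ∈ S) (hq : q ∈ S) (hpq : q ≠ p)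
    (hz : z ∉ S) : (insert z ((S.erase p).erase q)).card = S.card - 1 := by
  have h1 : q ∈ S.erase p := Finset.mem_erase.2 ⟨hpq, hq⟩
  have h2 := Finset.card_pos.2 ⟨q, h1⟩
  have h3 := Finset.card_erase_of_mem hp
  rw [Finset.card_insert_of_notMem (by simp [hz]), Finset.card_erase_of_mem h1]
  omega

/-- Bridgeless sets with one cycle. -/
lemma copCount_le_of_cycle (hX : Bridgeless G X) (hdeg : ∀ v ∈ X, deg G X v = 2) {k : ℕ}
    (hk : 2 ≤ k) :
    copCount G X (k + 1) ≤ (X.card - 1).choose k + if k + 1 < X.card then 1 else 0 := by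
  split_ifs with hkX
  · obtain ⟨u, hu⟩ := Finset.card_pos.1 (by omega : 0 < X.card)
    have hT : Theta G X u u := ⟨hX, hu, fun v hv _ _ => hdeg v hv, fun h => absurd rfl h⟩
    have huF := Finset.notMem_erase u X
    have h1 := copCount_add_card_le huF hT.forest (k := k) ∅ (by simp) (by simp) (by simp)
    rw [Finset.insert_erase hu, Finset.card_erase_of_mem hu] at h1
    -- A resistant set with `u` already uses both edges at each of its vertices, so no edge leaves
    -- it. The one possible resistant set accounts for the correction.
    have h2 : resistant G (X.erase u) u (k + 1) ⊆ {X.erase u} := by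
      intro S hS
      rw [Finset.mem_singleton]
      have hSF := (mem_resistant.1 hS).1.1
      have hcore := two_le_deg_of_mem_resistant huF hT.forest (by omega) hS
      have hH : insert u S ⊆ X :=
        Finset.insert_subset hu (hSF.trans (Finset.erase_subset _ _))
      have huS : u ∉ S := fun h => huF (hSF h)
      by_cases he : insert u S = X
      · rw [← he, Finset.erase_insert huS]
      · have := hX _ hH ⟨u, Finset.mem_insert_self _ _⟩ he
        rw [Finset.sum_eq_zero] at this
        · omega
        · intro a ha
          have e := deg_add_deg_sdiff (G := G) hH a
          have := hcore a ha
          have := hdeg a (hH ha)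
          omega
    have := Finset.card_le_card h2
    simp only [Finset.card_singleton, Finset.card_empty] at this h1
    omega
  · exact copCount_le_choose_of_card_le (by omega)

/-- Bridgeless sets consisting of two cycles with a common vertex. -/
lemma copCount_le_of_deg_four (h : Theta G X u u) (hu4 : deg G X u = 4) {k : ℕ} (hk : 3 ≤ k) :
    copCount G X (k + 1) ≤ (X.card - 1).choose k := by
  classical
  have hu := h.mem
  have huF := Finset.notMem_erase u X
  have hF := h.forest
  -- Deleting `u` removes four edges from `X.card + 1`, leaving too few to connect the other
  -- vertices.
  have hnF : ¬ Conn G (X.erase u) := by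
    intro hc
    have e : degSum G X = deg G X u + ∑ v ∈ X.erase u, deg G X v := by
      unfold degSum; rw [Finset.add_sum_erase _ _ hu]
    have e2 : ∑ v ∈ X.erase u, deg G X v = ∑ v ∈ X.erase u, 2 :=
      Finset.sum_congr rfl fun v hv => h.deg_eq v (Finset.mem_of_mem_erase hv)
        (Finset.ne_of_mem_erase hv) (Finset.ne_of_mem_erase hv)
    rw [Finset.sum_const, smul_eq_mul] at e2
    have e3 := degSum_erase (G := G) hu
    obtain ⟨x, hx, -⟩ := two_le_deg_iff.1 (show 2 ≤ deg G (X.erase u) u by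
      rw [deg_erase_self]; omega)
    have := hc.two_mul_card_le ⟨x, hx⟩
    omega
  -- A resistant set is one component of `X.erase u`: one of the two cycles without `u`.
  have facts : ∀ S ∈ resistant G (X.erase u) u (k + 1), u ∉ S ∧ insert u S ⊆ X ∧
      insert u S ≠ X ∧ (∀ s ∈ S, ∀ y ∈ X, y ≠ u → G.Adj s y → y ∈ S) ∧ deg G S u ≤ 2 := by
    intro S hS
    obtain ⟨⟨hSF, hcard⟩, hconn, -⟩ := mem_resistant.1 hS
    have hcore := two_le_deg_of_mem_resistant huF hF (by omega) hS
    have hH : insert u S ⊆ X := Finset.insert_subset hu (hSF.trans (Finset.erase_subset _ _))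
    have huS : u ∉ S := fun h => huF (hSF h)
    have hne : insert u S ≠ X := by
      intro e
      rw [← e, Finset.erase_insert huS] at hnF
      exact hnF hconn
    have h0 : ∀ s ∈ S, deg G (X \ insert u S) s = 0 := by
      intro s hs
      have e := deg_add_deg_sdiff (G := G) hH s
      have hs' : s ∈ insert u S := Finset.mem_insert_of_mem hs
      have := hcore s hs'
      have hsu : s ≠ u := fun h => huS (h ▸ hs)
      have := h.deg_eq s (hH hs') hsu hsu
      omega
    refine ⟨huS, hH, hne, ?_, ?_⟩
    · intro s hs y hy hyu hsy
      by_contra hyS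
      have : 0 < deg G (X \ insert u S) s :=
        deg_pos_iff.2 ⟨y, by simp [hy, hyu, hyS], hsy⟩
      have := h0 s hs
      omega
    · have := h.bridgeless _ hH ⟨u, Finset.mem_insert_self _ _⟩ hne
      rw [Finset.sum_insert huS, Finset.sum_eq_zero h0] at this
      have e := deg_add_deg_sdiff (G := G) hH u
      rw [deg_insert_self] at e
      omega
  have key := copCount_le_choose_of_replacement huF hF (k := k)
    (fun S T => 2 ≤ (T ∩ S).card ∧ (T \ S).card ≤ 1) ?_ ?_
  · rwa [Finset.insert_erase hu, Finset.card_erase_of_mem hu] at key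
  · intro S hS
    obtain ⟨⟨hSF, hcard⟩, hconn, -⟩ := mem_resistant.1 hS
    obtain ⟨huS, hH, hne, hcl, hdu⟩ := facts S hS
    obtain ⟨s, hs, hsu⟩ : ∃ s ∈ S, ¬ G.Adj u s := by
      by_contra! hall
      have : deg G S u = S.card := by
        unfold deg; rw [Finset.filter_true_of_mem hall]
      omega
    have hsne : s ≠ u := fun h => huS (h ▸ hs)
    have hsX : s ∈ X := hH (Finset.mem_insert_of_mem hs)
    obtain ⟨p, hp, q, hq, hpq, hsp, hsq, honly⟩ :=
      exists_pair_of_deg_eq_two (h.deg_eq s hsX hsne hsne)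
    have hpu : p ≠ u := fun h => hsu (h ▸ hsp.symm)
    have hqu : q ≠ u := fun h => hsu (h ▸ hsq.symm)
    have hpS := hcl s hs p hp hpu hsp
    have hqS := hcl s hs q hq hqu hsq
    obtain ⟨z, hz, hzH⟩ := Finset.exists_of_ssubset (hH.ssubset_of_ne hne)
    have hzS : z ∉ S := fun h => hzH (Finset.mem_insert_of_mem h)
    have hzu : z ≠ u := fun h => hzH (h ▸ Finset.mem_insert_self _ _)
    have hpz : p ≠ z := fun h => hzS (h ▸ hpS)
    have hqz : q ≠ z := fun h => hzS (h ▸ hqS)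
    have hsT : s ∈ insert z ((S.erase p).erase q) := by simp [hs, hsp.ne, hsq.ne]
    -- Removing both neighbours of `s` isolates it even in the presence of `u`. Since `z` lies in
    -- another component of `X.erase u`, no vertex of the forest can reconnect the new set.
    refine ⟨insert z ((S.erase p).erase q), ⟨?_, ?_⟩, ?_, ?_, ?_, ?_⟩
    · refine Finset.insert_subset (Finset.mem_erase.2 ⟨hzu, hz⟩) ?_
      exact ((Finset.erase_subset _ _).trans (Finset.erase_subset _ _)).trans hSF
    · rw [card_insert_erase_erase hpS hqS hpq.symm hzS, hcard]; rfl
    · intro hg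
      obtain ⟨y, hy, hsy⟩ := hg.conn.exists_adj (Finset.mem_insert_of_mem hsT)
        (Finset.mem_insert_self _ _) hsne.symm
      have hyX : y ∈ X := by
        simp only [Finset.mem_insert, Finset.mem_erase] at hy
        rcases hy with rfl | rfl | hy
        · exact hu
        · exact hz
        · exact hH (Finset.mem_insert_of_mem hy.2.2)
      rcases honly y hyX hsy with rfl | rfl
      · simp [hpu, hpz] at hy
      · simp [hqu, hqz] at hy
    · intro x hx hxT hc
      exfalso
      obtain ⟨a, ha, b, hb, haS, hbS, hab⟩ := hc (· ∈ S) ⟨s, Finset.mem_insert_of_mem hsT, hs⟩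
        ⟨z, by simp, hzS⟩
      have hb' : b ∈ X.erase u := by
        simp only [Finset.mem_insert, Finset.mem_erase] at hb ⊢
        rcases hb with rfl | rfl | hb
        · exact Finset.mem_erase.1 hx
        · exact ⟨hzu, hz⟩
        · exact absurd hb.2.2 hbS
      exact hbS (hcl a haS b (Finset.mem_of_mem_erase hb') (Finset.ne_of_mem_erase hb') hab)
    · have hsub : (S.erase p).erase q ⊆ insert z ((S.erase p).erase q) ∩ S := by
        intro t ht
        simp only [Finset.mem_inter, Finset.mem_insert]
        exact ⟨Or.inr ht, Finset.mem_of_mem_erase (Finset.mem_of_mem_erase ht)⟩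
      refine le_trans ?_ (Finset.card_le_card hsub)
      rw [Finset.card_erase_of_mem (Finset.mem_erase.2 ⟨hpq.symm, hqS⟩),
        Finset.card_erase_of_mem hpS]
      omega
    · rw [← Finset.card_singleton z]
      apply Finset.card_le_card
      intro t ht
      simp only [Finset.mem_sdiff, Finset.mem_insert, Finset.mem_erase] at ht
      rw [Finset.mem_singleton]
      tauto
  · rintro S₁ hS₁ S₂ hS₂ T ⟨h1, -⟩ ⟨-, h2⟩
    obtain ⟨⟨hSF₁, hcard₁⟩, hconn₁, -⟩ := mem_resistant.1 hS₁
    obtain ⟨⟨hSF₂, hcard₂⟩, -⟩ := mem_resistant.1 hS₂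
    obtain ⟨-, -, -, hcl, -⟩ := facts S₂ hS₂
    by_cases hdisj : ∃ a ∈ S₁, a ∈ S₂
    · apply Finset.eq_of_subset_of_card_le _ (by omega)
      intro b hb
      by_contra hb2
      obtain ⟨a, ha, c, hc, haS, hcS, hac⟩ := hconn₁ (· ∈ S₂) hdisj ⟨b, hb, hb2⟩
      have := Finset.mem_erase.1 (hSF₁ hc)
      exact hcS (hcl a haS c this.2 this.1 hac)
    · push Not at hdisj
      have : T ∩ S₁ ⊆ T \ S₂ := by
        intro t ht
        rw [Finset.mem_inter] at ht
        exact Finset.mem_sdiff.2 ⟨ht.1, hdisj t ht.2⟩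
      have := Finset.card_le_card this
      omega

/-! ### Bridgeless sets with two vertices of degree three: theta graphs -/

lemma Forest.no_triangle {F : Finset V} (hF : Forest G F) {x y z : V} (hx : x ∈ F) (hy : y ∈ F)
    (hz : z ∈ F) (hxy : G.Adj x y) (hyz : G.Adj y z) (hxz : G.Adj x z) : False := by
  have hc : Conn G {x, y} := (good_of_dominating (G := G) (c := x) (by simp) (by simp [hxy])).conn
  have := hF.deg_le_one (T := {x, y}) (by simp [Finset.insert_subset_iff, hx, hy]) hc hz
    (by simp [hxz.ne.symm, hyz.ne.symm])
  have : 2 ≤ deg G {x, y} z :=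
    two_le_deg_iff.2 ⟨x, by simp, y, by simp, hxy.ne, hxz.symm, hyz.symm⟩
  omega

lemma Forest.no_square {F : Finset V} (hF : Forest G F) {s t p q : V} (hs : s ∈ F) (ht : t ∈ F)
    (hp : p ∈ F) (hq : q ∈ F) (hst : s ≠ t) (hpq : p ≠ q) (hsp : G.Adj s p) (hsq : G.Adj s q)
    (htp : G.Adj t p) (htq : G.Adj t q) : False := by
  have hc : Conn G {s, p, q} :=
    (good_of_dominating (G := G) (c := s) (by simp) (by simp [hsp, hsq])).conn
  have := hF.deg_le_one (T := {s, p, q}) (by simp [Finset.insert_subset_iff, hs, hp, hq]) hc ht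
    (by simp [hst.symm, htp.ne, htq.ne])
  have : 2 ≤ deg G {s, p, q} t :=
    two_le_deg_iff.2 ⟨p, by simp, q, by simp, hpq, htp, htq⟩
  omega

/-- Either branch vertex can serve as the pivot; hence every core, in particular every triangle,
contains both. -/
lemma Theta.symm (h : Theta G X u w) (hw : w ∈ X) (hu : deg G X u ≤ 3) : Theta G X w u :=
  ⟨h.bridgeless, hw, fun v hv h1 h2 => h.deg_eq v hv h2 h1, fun _ => hu⟩

/-- Structure of a resistant set when `u` and `w` have degree three. -/
lemma Theta.resistant_structure (h : Theta G X u w) (hu : deg G X u = 3) (hwu : w ≠ u) {i : ℕ}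
    (hi : 3 ≤ i) (hiX : i + 1 < X.card) {S : Finset V}
    (hS : S ∈ resistant G (X.erase u) u i) :
    w ∈ S ∧ u ∉ S ∧ insert u S ⊆ X ∧ (∀ s ∈ S, s ≠ w → ∀ y ∈ X, G.Adj s y → y ∈ insert u S) ∧
      deg G (X \ insert u S) w = 1 ∧ deg G (X \ insert u S) u = 1 := by
  have huF := Finset.notMem_erase u X
  obtain ⟨⟨hSF, hcard⟩, hconn, -⟩ := mem_resistant.1 hS
  have hcore := two_le_deg_of_mem_resistant huF h.forest hi hS
  have hH : insert u S ⊆ X := Finset.insert_subset h.mem (hSF.trans (Finset.erase_subset _ _))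
  have huS : u ∉ S := fun h => huF (hSF h)
  have hne : insert u S ≠ X := by
    intro e
    rw [← e, Finset.card_insert_of_notMem huS] at hiX
    omega
  have hsplit := fun a => deg_add_deg_sdiff (G := G) hH a
  have h0 : ∀ s ∈ S, s ≠ w → deg G (X \ insert u S) s = 0 := by
    intro s hs hsw
    have e := hsplit s
    have hs' : s ∈ insert u S := Finset.mem_insert_of_mem hs
    have := hcore s hs'
    have hsu : s ≠ u := fun h => huS (h ▸ hs)
    have := h.deg_eq s (hH hs') hsu hsw
    omega
  have hbd := h.bridgeless _ hH ⟨u, Finset.mem_insert_self _ _⟩ hne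
  rw [Finset.sum_insert huS] at hbd
  have h1 : deg G (X \ insert u S) u ≤ 1 := by
    have := hsplit u
    have := hcore u (Finset.mem_insert_self _ _)
    omega
  have hwS : w ∈ S := by
    by_contra hwS
    rw [Finset.sum_eq_zero (fun s hs => h0 s hs fun e => hwS (e ▸ hs))] at hbd
    omega
  rw [Finset.sum_eq_single_of_mem w hwS (fun s hs hsw => h0 s hs hsw)] at hbd
  have h2 : deg G (X \ insert u S) w ≤ 1 := by
    have := hsplit w
    have := hcore w (Finset.mem_insert_of_mem hwS)
    have := h.deg_le hwu
    omega
  refine ⟨hwS, huS, hH, ?_, by omega, by omega⟩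
  intro s hs hsw y hy hsy
  by_contra hyS
  have : 0 < deg G (X \ insert u S) s := deg_pos_iff.2 ⟨y, Finset.mem_sdiff.2 ⟨hy, hyS⟩, hsy⟩
  have := h0 s hs hsw
  omega

/-- Two resistant sets which miss the same neighbour of `w` are equal. -/
lemma Theta.resistant_unique (h : Theta G X u w) (hu : deg G X u = 3) (hwu : w ≠ u) {i : ℕ}
    (hi : 3 ≤ i) (hiX : i + 1 < X.card) {S₁ S₂ : Finset V}
    (hS₁ : S₁ ∈ resistant G (X.erase u) u i) (hS₂ : S₂ ∈ resistant G (X.erase u) u i) {z : V}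
    (hz : z ∈ X) (hwz : G.Adj w z) (hz₁ : z ∉ insert u S₁) (hz₂ : z ∉ insert u S₂) : S₁ = S₂ := by
  obtain ⟨hw₁, hu₁, hH₁, hcl₁, hdw₁, hdu₁⟩ := h.resistant_structure hu hwu hi hiX hS₁
  obtain ⟨hw₂, hu₂, hH₂, hcl₂, hdw₂, hdu₂⟩ := h.resistant_structure hu hwu hi hiX hS₂
  have hc₁ := (mem_resistant.1 hS₁).1.2
  have hc₂ := (mem_resistant.1 hS₂).1.2
  symm
  apply Finset.eq_of_subset_of_card_le _ (by omega)
  intro b hb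
  by_contra hb₁
  -- Edges from `A` to the rest of `X` can only end at `u`, and at most one does, contradicting
  -- bridgelessness.
  set A := insert u S₂ \ insert u S₁ with hA
  have hAX : A ⊆ X := Finset.sdiff_subset.trans hH₂
  have huA : u ∉ A := by simp [hA]
  have hbA : b ∈ A := by
    rw [hA, Finset.mem_sdiff]
    refine ⟨Finset.mem_insert_of_mem hb, ?_⟩
    rw [Finset.mem_insert]
    rintro (rfl | h)
    · exact hu₂ hb
    · exact hb₁ h
  have hbd := h.bridgeless A hAX ⟨b, hbA⟩ (fun e => huA (e ▸ h.mem))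
  rw [deg_comm_sum, Finset.sum_eq_single_of_mem u (Finset.mem_sdiff.2 ⟨h.mem, huA⟩)] at hbd
  · have : deg G A u ≤ deg G (X \ insert u S₁) u :=
      deg_mono (Finset.sdiff_subset_sdiff hH₂ subset_rfl) u
    omega
  · intro y hy hyu
    rw [Finset.mem_sdiff] at hy
    by_contra hpos
    obtain ⟨a, ha, hya⟩ := deg_pos_iff.1 (Nat.pos_of_ne_zero hpos)
    have ha' := Finset.mem_sdiff.1 ha
    have hau : a ≠ u := fun e => huA (e ▸ ha)
    have haS₂ : a ∈ S₂ := (Finset.mem_insert.1 ha'.1).resolve_left hau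
    have haw : a ≠ w := fun e => ha'.2 (e ▸ Finset.mem_insert_of_mem hw₁)
    have hy₂ := hcl₂ a haS₂ haw y hy.1 hya.symm
    have hy₁ : y ∈ insert u S₁ := by
      by_contra hcon
      exact hy.2 (Finset.mem_sdiff.2 ⟨hy₂, hcon⟩)
    have hyS₁ := (Finset.mem_insert.1 hy₁).resolve_left hyu
    by_cases hyw : y = w
    · subst hyw
      have : a = z := eq_of_deg_le_one hdw₁.le (Finset.mem_sdiff.2 ⟨hAX ha, ha'.2⟩)
        (Finset.mem_sdiff.2 ⟨hz, hz₁⟩) hya hwz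
      exact hz₂ (this ▸ ha'.1)
    · exact ha'.2 (hcl₁ y hyS₁ hyw a (hAX ha) hya)

/-- Bridgeless sets with two vertices of degree three: subsets missing at least three vertices. -/
lemma copCount_le_of_theta (h : Theta G X u w) (hu : deg G X u = 3) (hwu : w ≠ u) {k : ℕ}
    (hk : 3 ≤ k) (hkX : k + 3 < X.card) : copCount G X (k + 1) ≤ (X.card - 1).choose k := by
  classical
  have huF := Finset.notMem_erase u X
  have hF := h.forest
  have struct := fun {S : Finset V} (hS : S ∈ resistant G (X.erase u) u (k + 1)) =>
    h.resistant_structure hu hwu (by omega) (by omega) hS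
  -- The cycle `insert u S` misses at least two vertices by `hkX`. If `z` were adjacent to `u`, the
  -- two exits from the cycle would both lead to `z`, and the other missed vertices would be cut
  -- off.
  have hzu : ∀ S ∈ resistant G (X.erase u) u (k + 1), ∀ z ∈ X, z ∉ insert u S → G.Adj w z →
      ¬ G.Adj z u := by
    intro S hS z hz hzH hwz hzu
    obtain ⟨hwS, huS, hH, hcl, hdw, hdu⟩ := struct hS
    have hcard := (mem_resistant.1 hS).1.2
    have hzne : z ≠ u := fun e => hzH (e ▸ Finset.mem_insert_self _ _)
    have hzw : z ≠ w := hwz.ne.symm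
    have hzX : z ∈ X \ insert u S := Finset.mem_sdiff.2 ⟨hz, hzH⟩
    set A := (X \ insert u S).erase z with hA
    have hAX : A ⊆ X := (Finset.erase_subset _ _).trans Finset.sdiff_subset
    have huA : u ∉ A := by simp [hA]
    have hAne : A.Nonempty := by
      apply Finset.card_pos.1
      rw [hA, Finset.card_erase_of_mem hzX, Finset.card_sdiff_of_subset hH,
        Finset.card_insert_of_notMem huS]
      omega
    have hbd := h.bridgeless A hAX hAne (fun e => huA (e ▸ h.mem))
    rw [Finset.sum_eq_zero] at hbd
    · omega
    · intro a ha
      have ha1 := Finset.ne_of_mem_erase ha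
      have ha2 := Finset.mem_of_mem_erase ha
      have ha3 := Finset.mem_sdiff.1 ha2
      by_contra hpos
      obtain ⟨y, hy, hay⟩ := deg_pos_iff.1 (Nat.pos_of_ne_zero hpos)
      rw [Finset.mem_sdiff] at hy
      by_cases hyH : y ∈ insert u S
      · rcases Finset.mem_insert.1 hyH with rfl | hyS
        · exact ha1 (eq_of_deg_le_one hdu.le ha2 hzX hay.symm hzu.symm)
        · by_cases hyw : y = w
          · subst hyw
            exact ha1 (eq_of_deg_le_one hdw.le ha2 hzX hay.symm hwz)
          · exact ha3.2 (hcl y hyS hyw a ha3.1 hay.symm)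
      · have hyz : y = z := by
          by_contra hyz
          exact hy.2 (Finset.mem_erase.2 ⟨hyz, Finset.mem_sdiff.2 ⟨hy.1, hyH⟩⟩)
        subst hyz
        have h1 := h.deg_eq y hz hzne hzw
        have h2 := three_le_deg h.mem (hH (Finset.mem_insert_of_mem hwS)) ha3.1 hwu.symm
          (fun e => ha3.2 (e ▸ Finset.mem_insert_self _ _))
          (fun e => ha3.2 (e ▸ Finset.mem_insert_of_mem hwS)) hzu hwz.symm hay.symm
        omega
  have hiso : ∀ S ∈ resistant G (X.erase u) u (k + 1), ∀ z ∈ X, z ∉ insert u S → G.Adj w z →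
      ∀ q, ∀ y ∈ insert u (insert z ((S.erase w).erase q)), ¬ G.Adj z y := by
    intro S hS z hz hzH hwz q y hy hzy
    obtain ⟨hwS, huS, hH, hcl, hdw, hdu⟩ := struct hS
    simp only [Finset.mem_insert, Finset.mem_erase] at hy
    rcases hy with rfl | rfl | hy
    · exact hzu S hS z hz hzH hwz hzy
    · exact hzy.ne rfl
    · exact hzH (hcl y hy.2.2 hy.2.1 z hz hzy.symm)
  -- The replacement swaps `w` and a neighbour `q` on the cycle for the first missed vertex `z`,
  -- which is isolated in the new set even with `u` added.
  have key := copCount_le_choose_of_replacement huF hF (k := k)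
    (fun S T => ∃ z ∈ X, z ∉ insert u S ∧ G.Adj w z ∧ ∃ q ∈ S, G.Adj w q ∧
      T = insert z ((S.erase w).erase q)) ?_ ?_
  · rwa [Finset.insert_erase h.mem, Finset.card_erase_of_mem h.mem] at key
  · intro S hS
    obtain ⟨hwS, huS, hH, hcl, hdw, hdu⟩ := struct hS
    obtain ⟨⟨hSF, hcard⟩, hconn, -⟩ := mem_resistant.1 hS
    obtain ⟨z, hz', hwz⟩ := deg_pos_iff.1 (by omega : 0 < deg G (X \ insert u S) w)
    obtain ⟨hz, hzH⟩ := Finset.mem_sdiff.1 hz'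
    have hzS : z ∉ S := fun h => hzH (Finset.mem_insert_of_mem h)
    have hzne : z ≠ u := fun h => hzH (h ▸ Finset.mem_insert_self _ _)
    obtain ⟨q, hqS, hwq, huq⟩ : ∃ q ∈ S, G.Adj w q ∧ ¬ G.Adj u q := by
      by_contra! hall
      have hsmall : deg G S w ≤ 2 := by
        have h1 := deg_add_deg_sdiff (G := G) hH w
        have h2 := deg_mono (G := G) (Finset.subset_insert u S) w
        have := h.deg_le hwu
        omega
      obtain ⟨t, ht, htw⟩ : ∃ t ∈ S, ¬ (t = w ∨ G.Adj w t) := by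
        by_contra! hcon
        have h1 : S.erase w ⊆ S.filter (G.Adj w) := by
          intro t ht
          exact Finset.mem_filter.2 ⟨Finset.mem_of_mem_erase ht,
            (hcon t (Finset.mem_of_mem_erase ht)).resolve_left (Finset.ne_of_mem_erase ht)⟩
        have h2 := Finset.card_le_card h1
        rw [Finset.card_erase_of_mem hwS] at h2
        unfold deg at hsmall
        omega
      obtain ⟨a, ha, b, hb, hPa, hPb, hab⟩ := hconn (fun t => t = w ∨ G.Adj w t)
        ⟨w, hwS, Or.inl rfl⟩ ⟨t, ht, htw⟩
      push Not at hPb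
      rcases hPa with rfl | hwa
      · exact hPb.2 hab
      · have hau : a ≠ u := fun e => huS (e ▸ ha)
        have haX := hH (Finset.mem_insert_of_mem ha)
        have h1 := h.deg_eq a haX hau hwa.ne.symm
        have h2 := three_le_deg h.mem (hH (Finset.mem_insert_of_mem hwS))
          (hH (Finset.mem_insert_of_mem hb)) hwu.symm (fun e => huS (e ▸ hb)) hPb.1.symm
          (hall a ha hwa).symm hwa.symm hab
        omega
    have hqz : q ≠ z := fun h => hzS (h ▸ hqS)
    have hTF : insert z ((S.erase w).erase q) ⊆ X.erase u := by
      refine Finset.insert_subset (Finset.mem_erase.2 ⟨hzne, hz⟩) ?_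
      exact ((Finset.erase_subset _ _).trans (Finset.erase_subset _ _)).trans hSF
    refine ⟨insert z ((S.erase w).erase q), ⟨hTF, ?_⟩, ?_, ?_, z, hz, hzH, hwz, q, hqS, hwq, rfl⟩
    · rw [card_insert_erase_erase hwS hqS hwq.ne.symm hzS, hcard]; rfl
    · intro hg
      obtain ⟨y, hy, hzy⟩ := hg.conn.exists_adj
        (Finset.mem_insert_of_mem (Finset.mem_insert_self z _)) (Finset.mem_insert_self _ _)
        hzne.symm
      exact hiso S hS z hz hzH hwz q y hy hzy
    · intro x hx hxT hc
      exfalso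
      have hqX : q ∈ X := hH (Finset.mem_insert_of_mem hqS)
      have hqu : q ≠ u := fun e => huS (e ▸ hqS)
      -- Putting `w` back fails because `q`, joined to `w` and to a further vertex of `S`, would
      -- close a cycle. Any other vertex fails because in the forest `S` can be left only through
      -- `w`.
      by_cases hxw : x = w
      · subst hxw
        obtain ⟨q', hq', hne, hqq'⟩ : ∃ q' ∈ X, q' ≠ x ∧ G.Adj q q' := by
          obtain ⟨a, ha, b, hb, hab, h1, h2, -⟩ :=
            exists_pair_of_deg_eq_two (h.deg_eq q hqX hqu hwq.ne.symm)
          by_cases hax : a = x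
          · exact ⟨b, hb, fun e => hab (hax.trans e.symm), h2⟩
          · exact ⟨a, ha, hax, h1⟩
        have hq'u : q' ≠ u := fun e => huq (e ▸ hqq'.symm)
        have hq'S := (Finset.mem_insert.1 (hcl q hqS hwq.ne.symm q' hq' hqq')).resolve_left hq'u
        have h1 := hF.deg_le_one (Finset.insert_subset hx hTF) hc (hSF hqS)
          (by simp [hwq.ne.symm, hqz])
        have h2 : 2 ≤ deg G (insert x (insert z ((S.erase x).erase q))) q :=
          two_le_deg_iff.2 ⟨x, by simp, q', by simp [hne, hq'S, hqq'.ne.symm], hne.symm,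
            hwq.symm, hqq'⟩
        omega
      · obtain ⟨t, ht⟩ : ((S.erase w).erase q).Nonempty := by
          apply Finset.card_pos.1
          rw [Finset.card_erase_of_mem (Finset.mem_erase.2 ⟨hwq.ne.symm, hqS⟩),
            Finset.card_erase_of_mem hwS]
          omega
        obtain ⟨a, ha, b, hb, haS, hbS, hab⟩ := hc (· ∈ S)
          ⟨t, by simp [ht], Finset.mem_of_mem_erase (Finset.mem_of_mem_erase ht)⟩
          ⟨z, by simp, hzS⟩
        have haw : a ≠ w := by
          rintro rfl
          simp [Ne.symm hxw, hwz.ne] at ha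
        have hb' := Finset.mem_erase.1 (Finset.insert_subset hx hTF hb)
        exact hbS ((Finset.mem_insert.1 (hcl a haS haw b hb'.2 hab)).resolve_left hb'.1)
  · rintro S₁ hS₁ S₂ hS₂ T ⟨z₁, hz₁, hzH₁, hwz₁, q₁, hqS₁, hwq₁, rfl⟩
      ⟨z₂, hz₂, hzH₂, hwz₂, q₂, hqS₂, hwq₂, hT⟩
    obtain ⟨hwS, huS, hH, hcl, hdw, hdu⟩ := struct hS₁
    have hSF := (mem_resistant.1 hS₁).1.1
    -- The replacement determines `z`: otherwise `z₂` lies in `S₁` and keeps a neighbour in the new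
    -- set or in `u`, although it should be isolated.
    have e : z₂ = z₁ := by
      by_contra hne
      have hmem : z₂ ∈ insert z₁ ((S₁.erase w).erase q₁) := by rw [hT]; simp
      have hm := (Finset.mem_insert.1 hmem).resolve_left hne
      simp only [Finset.mem_erase] at hm
      have hcore := two_le_deg_of_mem_resistant huF hF (by omega) hS₁ z₂
        (Finset.mem_insert_of_mem hm.2.2)
      obtain ⟨t, ht, htw, hzt⟩ : ∃ t ∈ insert u S₁, t ≠ w ∧ G.Adj z₂ t := by
        obtain ⟨a, ha, b, hb, hab, h1, h2⟩ := two_le_deg_iff.1 hcore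
        by_cases haw : a = w
        · exact ⟨b, hb, fun e => hab (haw.trans e.symm), h2⟩
        · exact ⟨a, ha, haw, h1⟩
      have hno := hiso S₂ hS₂ z₂ hz₂ hzH₂ hwz₂ q₂ t
      rw [← hT] at hno
      refine hno ?_ hzt
      rcases Finset.mem_insert.1 ht with rfl | htS
      · exact Finset.mem_insert_self _ _
      · by_cases htq : t = q₁
        · subst htq
          exact (hF.no_triangle (hSF hwS) (hSF hm.2.2) (hSF hqS₁) hwz₂ hzt hwq₁).elim
        · simp [htS, htw, htq]
    subst e
    exact h.resistant_unique hu hwu (by omega) (by omega) hS₁ hS₂ hz₂ hwz₂ hzH₁ hzH₂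

/-- There are only `k + 2` candidate sets and the bound is `k + 1`, so a single bad one suffices. -/
lemma copCount_le_of_exists_erase {k : ℕ} (hX : X.card = k + 2) {y : V} (hy : y ∈ X)
    (hbad : ¬ Good G (X.erase y)) : copCount G X (k + 1) ≤ (X.card - 1).choose k := by
  classical
  have hm : X.erase y ∈ X.powersetCard (k + 1) :=
    Finset.mem_powersetCard.2 ⟨Finset.erase_subset _ _, by rw [Finset.card_erase_of_mem hy]; omega⟩
  have h1 : copCount G X (k + 1) ≤ ((X.powersetCard (k + 1)).erase (X.erase y)).card := by
    unfold copCount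
    apply Finset.card_le_card
    intro S hS
    rw [Finset.mem_filter] at hS
    exact Finset.mem_erase.2 ⟨fun e => hbad (e ▸ hS.2), hS.1⟩
  rw [Finset.card_erase_of_mem hm, Finset.card_powersetCard, hX] at h1
  rw [hX]
  have e1 : (k + 2).choose (k + 1) = k + 2 := Nat.choose_succ_self_right (k + 1)
  have e2 : (k + 2 - 1).choose k = k + 1 := Nat.choose_succ_self_right k
  omega

lemma degSum_of_theta (h : Theta G X u w) (hu : deg G X u = 3) (hw : w ∈ X) (hwu : w ≠ u)
    (hw3 : deg G X w = 3) : degSum G X = 2 * X.card + 2 := by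
  have hwF : w ∈ X.erase u := Finset.mem_erase.2 ⟨hwu, hw⟩
  unfold degSum
  rw [← Finset.add_sum_erase _ _ h.mem, ← Finset.add_sum_erase _ _ hwF, hu, hw3,
    Finset.sum_congr rfl fun v hv => h.deg_eq v (Finset.mem_of_mem_erase (Finset.mem_of_mem_erase hv))
      (Finset.ne_of_mem_erase (Finset.mem_of_mem_erase hv)) (Finset.ne_of_mem_erase hv),
    Finset.sum_const, smul_eq_mul, Finset.card_erase_of_mem hwF, Finset.card_erase_of_mem h.mem]
  have := Finset.card_pos.2 ⟨w, hwF⟩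
  rw [Finset.card_erase_of_mem h.mem] at this
  omega

/-- A triangle in a theta graph consists of `u`, `w` and a common neighbour. -/
lemma Theta.triangle (h : Theta G X u w) (hu : deg G X u = 3) (hw : w ∈ X) {x y z : V}
    (hwu : w ≠ u)
    (hx : x ∈ X) (hy : y ∈ X) (hz : z ∈ X) (hxy : G.Adj x y) (hyz : G.Adj y z) (hxz : G.Adj x z) :
    G.Adj u w ∧ ∃ t ∈ ({x, y, z} : Finset V), G.Adj u t ∧ G.Adj w t := by
  have hD : ({x, y, z} : Finset V) ⊆ X := by simp [Finset.insert_subset_iff, hx, hy, hz]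
  have hcore : ∀ v ∈ ({x, y, z} : Finset V), 2 ≤ deg G {x, y, z} v := by
    intro v hv
    simp only [Finset.mem_insert, Finset.mem_singleton] at hv
    rw [two_le_deg_iff]
    rcases hv with rfl | rfl | rfl
    · exact ⟨y, by simp, z, by simp, hyz.ne, hxy, hxz⟩
    · exact ⟨x, by simp, z, by simp, hxz.ne, hxy.symm, hyz⟩
    · exact ⟨x, by simp, y, by simp, hxy.ne, hxz.symm, hyz.symm⟩
  have h1 := h.eq_of_core hD ⟨x, by simp⟩ hcore
  have h2 := (h.symm hw hu.le).eq_of_core hD ⟨x, by simp⟩ hcore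
  simp only [Finset.mem_insert, Finset.mem_singleton] at h1 h2
  rcases h1 with rfl | rfl | rfl <;> rcases h2 with rfl | rfl | rfl <;>
    simp_all [G.adj_comm]

/-- A bridgeless set with two vertices of degree three: one vertex missing. -/
lemma exists_not_good_erase (h : Theta G X u w) (hu : deg G X u = 3) (hw : w ∈ X) (hwu : w ≠ u)
    (hw3 : deg G X w = 3) (h5 : 5 ≤ X.card) : ∃ y ∈ X, ¬ Good G (X.erase y) := by
  have hsum := degSum_of_theta h hu hw hwu hw3
  -- Deleting a vertex of degree two leaves as many edges as vertices, hence a cycle; it remains to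
  -- destroy all triangles.
  have hbad : ∀ y ∈ X, y ≠ u → y ≠ w →
      (∀ t ∈ X, t ≠ y → G.Adj u w → G.Adj u t → ¬ G.Adj w t) → ¬ Good G (X.erase y) := by
    intro y hy hyu hyw hno
    have h1 := degSum_erase (G := G) hy
    rw [h.deg_eq y hy hyu hyw] at h1
    have h2 := Finset.card_erase_of_mem hy
    refine not_good_of_triangleFree (Finset.card_pos.1 (by omega)) (by omega) ?_
    intro a ha b hb c hc hab hbc hac
    obtain ⟨huw, t, ht, hut, hwt⟩ := h.triangle hu hw hwu (Finset.mem_of_mem_erase ha)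
      (Finset.mem_of_mem_erase hb) (Finset.mem_of_mem_erase hc) hab hbc hac
    have ht' : t ∈ X.erase y := by
      simp only [Finset.mem_insert, Finset.mem_singleton] at ht
      rcases ht with rfl | rfl | rfl <;> assumption
    exact hno t (Finset.mem_of_mem_erase ht') (Finset.ne_of_mem_erase ht') huw hut hwt
  by_cases hex : ∃ t ∈ X, G.Adj u w ∧ G.Adj u t ∧ G.Adj w t
  · obtain ⟨t, ht, huw, hut, hwt⟩ := hex
    refine ⟨t, ht, hbad t ht hut.ne.symm hwt.ne.symm ?_⟩
    -- A second common neighbour of `u` and `w` would make these four vertices a set without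
    -- boundary, hence all of `X`.
    intro s hs hst _ hus hws
    set A : Finset V := {u, w, t, s} with hA
    have hAX : A ⊆ X := by simp [hA, Finset.insert_subset_iff, h.mem, hw, ht, hs]
    have hne : A ≠ X := by
      intro e
      have := Finset.card_le_four (a := u) (b := w) (c := t) (d := s)
      rw [← hA, e] at this
      omega
    have hbd := h.bridgeless A hAX ⟨u, by simp [hA]⟩ hne
    rw [Finset.sum_eq_zero] at hbd
    · omega
    · intro a ha
      have e := deg_add_deg_sdiff (G := G) hAX a
      simp only [hA, Finset.mem_insert, Finset.mem_singleton] at ha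
      have huA : u ∈ A := by simp [hA]
      have hwA : w ∈ A := by simp [hA]
      have htA : t ∈ A := by simp [hA]
      have hsA : s ∈ A := by simp [hA]
      rcases ha with rfl | rfl | rfl | rfl
      · have := three_le_deg hwA htA hsA hwt.ne hws.ne hst.symm huw hut hus
        omega
      · have := three_le_deg huA htA hsA hut.ne hus.ne hst.symm huw.symm hwt hws
        omega
      · have := two_le_deg_iff.2 ⟨u, huA, w, hwA, hwu.symm, hut.symm, hwt.symm⟩
        have := h.deg_eq a ht hut.ne.symm hwt.ne.symm
        omega
      · have := two_le_deg_iff.2 ⟨u, huA, w, hwA, hwu.symm, hus.symm, hws.symm⟩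
        have := h.deg_eq a hs hus.ne.symm hws.ne.symm
        omega
  · obtain ⟨y, hy, hyA⟩ : ∃ y ∈ X, y ∉ ({u, w} : Finset V) :=
      Finset.exists_mem_notMem_of_card_lt_card (Finset.card_le_two.trans_lt (by omega))
    simp only [Finset.mem_insert, Finset.mem_singleton, not_or] at hyA
    exact ⟨y, hy, hbad y hy hyA.1 hyA.2 fun t ht _ h1 h2 h3 => hex ⟨t, ht, h1, h2, h3⟩⟩

open Classical in
/-- Bridgeless sets with two vertices of degree three: two vertices missing. -/
lemma copCount_le_of_theta_sub_two (h : Theta G X u w) (hu : deg G X u = 3) (hw : w ∈ X)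
    (hwu : w ≠ u) (hw3 : deg G X w = 3) {k : ℕ} (hk : 3 ≤ k) (hkX : X.card = k + 3) :
    copCount G X (k + 1) ≤ (X.card - 1).choose k + if k = 3 then 1 else 0 := by
  have hsum := degSum_of_theta h hu hw hwu hw3
  have huF := Finset.notMem_erase u X
  have hF := h.forest
  set F := X.erase u with hFdef
  have hXF : insert u F = X := Finset.insert_erase h.mem
  have hcF : F.card = k + 2 := by rw [hFdef, Finset.card_erase_of_mem h.mem]; omega
  have hwF : w ∈ F := Finset.mem_erase.2 ⟨hwu, hw⟩
  have hFX : F ⊆ X := Finset.erase_subset _ _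
  have hdF : ∀ v ∈ F, deg G X v = deg G F v + if G.Adj v u then 1 else 0 := by
    intro v _
    rw [← hXF, deg_insert huF]
  have huF3 : deg G F u = 3 := by rw [hFdef, deg_erase_self, hu]
  have h1 := copCount_insert (G := G) huF k
  have h2 := card_good_add_card_bad (G := G) F u k
  rw [hXF] at h1
  rw [hkX, show k + 3 - 1 = k + 2 from rfl]
  rw [hcF] at h2
  set L := (F.filter (G.Adj u)).erase w with hL
  set B := (F.powersetCard k).filter fun T => ¬ Good G (insert u T) with hB
  have hcardL : L.card = if G.Adj u w then 2 else 3 := by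
    unfold deg at huF3
    split_ifs with huw
    · rw [hL, Finset.card_erase_of_mem (Finset.mem_filter.2 ⟨hwF, huw⟩), huF3]
    · rw [hL, Finset.erase_eq_of_notMem (by simp [huw]), huF3]
  -- A set avoiding `u` is `F` minus one vertex `y`, and connectivity forces `y` to be a leaf of the
  -- forest `F`, that is, a neighbour of `u` other than `w`.
  have hgood : copCount G F (k + 1) ≤ L.card := by
    refine le_trans (Finset.card_le_card ?_) (Finset.card_image_le (s := L) (f := F.erase))
    intro S hS
    rw [Finset.mem_filter, Finset.mem_powersetCard] at hS
    obtain ⟨⟨hSF, hcS⟩, hg⟩ := hS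
    obtain ⟨y, hy⟩ : ∃ y, F \ S = {y} := by
      rw [← Finset.card_eq_one, Finset.card_sdiff_of_subset hSF]; omega
    have hyF : y ∈ F ∧ y ∉ S := by
      rw [← Finset.mem_sdiff, hy]; simp
    have hSe : S = F.erase y := by
      apply Finset.eq_of_subset_of_card_le
      · intro s hs
        exact Finset.mem_erase.2 ⟨fun e => hyF.2 (e ▸ hs), hSF hs⟩
      · rw [Finset.card_erase_of_mem hyF.1]; omega
    have hd := hF.deg_le_one hSF hg.conn hyF.1 hyF.2
    rw [hSe, deg_erase_self] at hd
    have hdy := hdF y hyF.1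
    have hge := h.bridgeless.two_le_deg (by omega) (hFX hyF.1)
    refine Finset.mem_image.2 ⟨y, ?_, hSe.symm⟩
    rw [hL, Finset.mem_erase, Finset.mem_filter]
    refine ⟨?_, hyF.1, ?_⟩
    · rintro rfl
      split_ifs at hdy <;> omega
    · by_contra hyu
      rw [if_neg (fun e => hyu e.symm)] at hdy
      omega
  set M := F.filter fun s => s ≠ w ∧ ¬ G.Adj u s with hM
  have hcardM : M.card + (L.card + 1) = k + 2 := by
    have e : F.filter (fun s => ¬ (s ≠ w ∧ ¬ G.Adj u s)) = insert w L := by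
      ext s
      simp only [hL, Finset.mem_filter, Finset.mem_insert, Finset.mem_erase]
      by_cases hsw : s = w
      · subst hsw; simp [hwF]
      · simp [hsw]
    rw [← hcF, ← Finset.card_filter_add_card_filter_not (s := F)
      (fun s => s ≠ w ∧ ¬ G.Adj u s), e, Finset.card_insert_of_notMem (by simp [hL])]
  have hMs : ∀ s ∈ M, s ∈ F ∧ s ≠ w ∧ ¬ G.Adj u s ∧ deg G F s = 2 := by
    intro s hs
    rw [hM, Finset.mem_filter] at hs
    refine ⟨hs.1, hs.2.1, hs.2.2, ?_⟩
    have := hdF s hs.1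
    rw [if_neg (fun e => hs.2.2 e.symm),
      h.deg_eq s (hFX hs.1) (Finset.ne_of_mem_erase hs.1) hs.2.1] at this
    omega
  -- For `s` in `M` this deletes exactly the two neighbours of `s` and isolates it. Distinct `s`
  -- give distinct sets, since a forest has no 4-cycle.
  set f : V → Finset V := fun s => F.filter fun t => ¬ G.Adj s t with hf
  have hfB : ∀ s ∈ M, f s ∈ B := by
    intro s hs
    obtain ⟨hsF, hsw, hsu, hd⟩ := hMs s hs
    rw [hB, Finset.mem_filter, Finset.mem_powersetCard]
    refine ⟨⟨Finset.filter_subset _ _, ?_⟩, ?_⟩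
    · have := Finset.card_filter_add_card_filter_not (s := F) (G.Adj s)
      unfold deg at hd
      simp only [hf]
      omega
    · intro hg
      have hsf : s ∈ f s := Finset.mem_filter.2 ⟨hsF, G.loopless.irrefl s⟩
      obtain ⟨y, hy, hsy⟩ := hg.conn.exists_adj (Finset.mem_insert_of_mem hsf)
        (Finset.mem_insert_self _ _) (Finset.ne_of_mem_erase hsF).symm
      rcases Finset.mem_insert.1 hy with rfl | hy
      · exact hsu hsy.symm
      · exact (Finset.mem_filter.1 hy).2 hsy
  have hfadj : ∀ s t, f s = f t → ∀ p ∈ F, G.Adj s p → G.Adj t p := by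
    intro s t e p hp hsp
    by_contra htp
    have : p ∈ f s := by rw [e]; exact Finset.mem_filter.2 ⟨hp, htp⟩
    exact (Finset.mem_filter.1 this).2 hsp
  have hfinj : Set.InjOn f (M : Set V) := by
    intro s hs t ht e
    obtain ⟨hsF, -, -, hd⟩ := hMs s hs
    obtain ⟨htF, -, -, -⟩ := hMs t ht
    obtain ⟨p, hp, q, hq, hpq, hsp, hsq⟩ := two_le_deg_iff.1 hd.ge
    by_contra hne
    exact hF.no_square hsF htF hp hq hne hpq hsp hsq (hfadj s t e p hp hsp) (hfadj s t e q hq hsq)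
  by_cases huw : G.Adj u w
  · rw [if_pos huw] at hcardL
    have : M.card ≤ B.card := by
      rw [← Finset.card_image_of_injOn hfinj]
      exact Finset.card_le_card (Finset.image_subset_iff.2 hfB)
    omega
  · rw [if_neg huw] at hcardL
    obtain ⟨p, hp, q, hq, hpw, hqw, hpq⟩ :
        ∃ p ∈ F, ∃ q ∈ F, p ≠ w ∧ q ≠ w ∧ G.Adj p q := by
      by_contra! hno
      have hsub : F.erase w ⊆ F.filter (G.Adj u) := by
        intro v hv
        obtain ⟨hvw, hvF⟩ := Finset.mem_erase.1 hv
        have hd := h.deg_eq v (hFX hvF) (Finset.ne_of_mem_erase hvF) hvw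
        have hdv := hdF v hvF
        have hd1 : deg G F v ≤ 1 := by
          by_contra! h2
          obtain ⟨a, ha, b, hb, hab, hva, hvb⟩ := two_le_deg_iff.1 h2
          by_cases haw : a = w
          · exact hno v hvF b hb hvw (fun e => hab (haw.trans e.symm)) hvb
          · exact hno v hvF a ha hvw haw hva
        rw [Finset.mem_filter]
        refine ⟨hvF, ?_⟩
        by_contra hvu
        rw [if_neg (fun e => hvu e.symm)] at hdv
        omega
      have := Finset.card_le_card hsub
      rw [Finset.card_erase_of_mem hwF] at this
      unfold deg at huF3
      omega
    have hqp : q ∈ X.erase p := Finset.mem_erase.2 ⟨hpq.ne.symm, hFX hq⟩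
    -- One more bad set: deleting both ends of an edge removes two vertices and only three edges, so
    -- a cycle remains, and there is no triangle because `u` and `w` are not adjacent.
    have hpqB : (F.erase p).erase q ∈ B := by
      have hqp' : q ∈ F.erase p := Finset.mem_erase.2 ⟨hpq.ne.symm, hq⟩
      have hc : ((F.erase p).erase q).card = k := by
        rw [Finset.card_erase_of_mem hqp', Finset.card_erase_of_mem hp]; omega
      rw [hB, Finset.mem_filter, Finset.mem_powersetCard]
      refine ⟨⟨(Finset.erase_subset _ _).trans (Finset.erase_subset _ _), hc⟩, ?_⟩
      have hsub : insert u ((F.erase p).erase q) = (X.erase p).erase q := by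
        rw [← hXF, Finset.erase_insert_of_ne (Finset.ne_of_mem_erase hp).symm,
          Finset.erase_insert_of_ne (Finset.ne_of_mem_erase hq).symm]
      rw [hsub]
      have hc' : ((X.erase p).erase q).card = k + 1 := by
        rw [← hsub, Finset.card_insert_of_notMem (by simp [hFdef]), hc]
      have e1 := degSum_erase (G := G) (hFX hp)
      have e2 := degSum_erase (G := G) hqp
      have e3 : deg G X q = deg G (X.erase p) q + 1 := by
        conv_lhs => rw [← Finset.insert_erase (hFX hp)]
        rw [deg_insert (Finset.notMem_erase _ _), if_pos hpq.symm]
      have e4 := h.deg_eq p (hFX hp) (Finset.ne_of_mem_erase hp) hpw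
      have e5 := h.deg_eq q (hFX hq) (Finset.ne_of_mem_erase hq) hqw
      refine not_good_of_triangleFree (Finset.card_pos.1 (by omega)) (by omega) ?_
      intro a ha b hb c hc hab hbc hac
      have hm : ∀ {v}, v ∈ (X.erase p).erase q → v ∈ X := fun hv =>
        Finset.mem_of_mem_erase (Finset.mem_of_mem_erase hv)
      exact huw (h.triangle hu hw hwu (hm ha) (hm hb) (hm hc) hab hbc hac).1
    have : M.card + 1 ≤ B.card := by
      rw [← Finset.card_image_of_injOn hfinj, ← Finset.card_insert_of_notMem (a := (F.erase p).erase q)]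
      · exact Finset.card_le_card (Finset.insert_subset hpqB (Finset.image_subset_iff.2 hfB))
      · rw [Finset.mem_image]
        rintro ⟨s, hs, e⟩
        have hsF := (hMs s hs).1
        have hadj : ∀ r ∈ F, r ∉ (F.erase p).erase q → G.Adj s r := by
          intro r hr hrn
          by_contra hsr
          exact hrn (e ▸ Finset.mem_filter.2 ⟨hr, hsr⟩)
        exact hF.no_triangle hp hq hsF hpq (hadj q hq (by simp)).symm (hadj p hp (by simp)).symm
    -- With three sets gained and at least `k - 1` lost, the surplus is at most `4 - k`, positive
    -- only for `k = 3`.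
    split_ifs with hk3 <;> omega

/-- Bridgeless sets inducing one edge more than vertices. -/
lemma copCount_le_of_bridgeless (hX : Bridgeless G X) (hsum : degSum G X = 2 * X.card + 2) {k : ℕ}
    (hk : 3 ≤ k) :
    copCount G X (k + 1) ≤ (X.card - 1).choose k + if X.card = 6 ∧ k = 3 then 1 else 0 := by
  rcases Nat.lt_or_ge (k + 1) X.card with hkX | hkX
  swap
  · exact (copCount_le_choose_of_card_le hkX).trans (Nat.le_add_right _ _)
  have hge : ∀ v ∈ X, 2 ≤ deg G X v := fun v hv => hX.two_le_deg (by omega) hv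
  -- The degrees exceed two by a total of two: either one vertex has degree four, or two have degree
  -- three.
  have hexc : ∑ v ∈ X, (deg G X v - 2) = 2 := by
    have h1 : degSum G X = ∑ v ∈ X, ((deg G X v - 2) + 2) :=
      Finset.sum_congr rfl fun v hv => by have := hge v hv; omega
    rw [Finset.sum_add_distrib, Finset.sum_const, smul_eq_mul] at h1
    omega
  obtain ⟨u, hu, hu0⟩ := Finset.exists_ne_zero_of_sum_ne_zero (by omega :
    ∑ v ∈ X, (deg G X v - 2) ≠ 0)
  have hrest := hexc
  rw [← Finset.add_sum_erase _ _ hu] at hrest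
  have hz : ∀ {A : Finset V} {v}, ∑ v ∈ A, (deg G X v - 2) = 0 → v ∈ A → v ∈ X → deg G X v = 2 := by
    intro A v h hv hvX
    have := Finset.sum_eq_zero_iff.1 h v hv
    have := hge v hvX
    omega
  by_cases hu4 : deg G X u = 4
  · have hT : Theta G X u u := by
      refine ⟨hX, hu, fun v hv hvu _ => ?_, fun h => absurd rfl h⟩
      exact hz (A := X.erase u) (by omega) (Finset.mem_erase.2 ⟨hvu, hv⟩) hv
    exact (copCount_le_of_deg_four hT hu4 hk).trans (Nat.le_add_right _ _)
  · have hu3 : deg G X u = 3 := by omega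
    obtain ⟨w, hw, hw0⟩ := Finset.exists_ne_zero_of_sum_ne_zero (by omega :
      ∑ v ∈ X.erase u, (deg G X v - 2) ≠ 0)
    rw [← Finset.add_sum_erase _ _ hw] at hrest
    obtain ⟨hwu, hwX⟩ := Finset.mem_erase.1 hw
    have hT : Theta G X u w := by
      refine ⟨hX, hu, fun v hv hvu hvw => ?_, fun _ => by omega⟩
      exact hz (A := (X.erase u).erase w) (by omega)
        (Finset.mem_erase.2 ⟨hvw, Finset.mem_erase.2 ⟨hvu, hv⟩⟩) hv
    have hw3 : deg G X w = 3 := by omega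
    by_cases h1 : X.card = k + 2
    · obtain ⟨y, hy, hbad⟩ := exists_not_good_erase hT hu3 hwX hwu hw3 (by omega)
      exact (copCount_le_of_exists_erase h1 hy hbad).trans (Nat.le_add_right _ _)
    · by_cases h2 : X.card = k + 3
      · refine (copCount_le_of_theta_sub_two hT hu3 hwX hwu hw3 hk h2).trans ?_
        split_ifs <;> omega
      · exact (copCount_le_of_theta hT hu3 hwu hk (by omega)).trans (Nat.le_add_right _ _)

/-! ### Superadditivity of binomial coefficients -/

section Binomials

lemma choose_add_choose_le (x y : ℕ) {k : ℕ} (hk : 1 ≤ k) :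
    x.choose k + y.choose k ≤ (x + y).choose k := by
  induction y with
  | zero => rw [Nat.choose_eq_zero_of_lt (by omega : 0 < k)]; simp
  | succ y ih =>
    obtain ⟨j, rfl⟩ := Nat.exists_eq_add_of_le' hk
    have h1 := Nat.choose_succ_succ y j
    have h2 := Nat.choose_succ_succ (x + y) j
    have h3 := Nat.choose_le_choose j (Nat.le_add_left y x)
    simp only [Nat.succ_eq_add_one] at *
    rw [← add_assoc]
    omega

/-- The third term counts the sets made of one fixed element of the first part and `j` elements of
the second. It is the slack that absorbs corrections at a bridge. -/
lemma choose_add_choose_add_choose_le {x : ℕ} (hx : 1 ≤ x) (y : ℕ) {j : ℕ} (hj : 1 ≤ j) :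
    x.choose (j + 1) + y.choose (j + 1) + y.choose j ≤ (x + y).choose (j + 1) := by
  obtain ⟨x, rfl⟩ := Nat.exists_eq_add_of_le' hx
  have h1 := choose_add_choose_le x (y + 1) (Nat.le_add_left 1 j)
  have h2 := Nat.choose_succ_succ y j
  have h3 := Nat.choose_succ_succ x j
  have h4 := Nat.choose_succ_succ (x + y) j
  have h5 := choose_add_choose_le x y (Nat.le_add_left 1 j)
  have h6 := choose_add_choose_le x y hj
  simp only [Nat.succ_eq_add_one] at *
  rw [show x + 1 + y = x + y + 1 by ring]
  omega

lemma two_le_choose {x j : ℕ} (hj : 1 ≤ j) (hx : j < x) : 2 ≤ x.choose j := by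
  obtain ⟨j, rfl⟩ := Nat.exists_eq_add_of_le' hj
  obtain ⟨x, rfl⟩ := Nat.exists_eq_add_of_le' (by omega : 1 ≤ x)
  have h1 := Nat.choose_succ_succ x j
  have h2 := Nat.choose_pos (by omega : j ≤ x)
  have h3 := Nat.choose_pos (by omega : j + 1 ≤ x)
  simp only [Nat.succ_eq_add_one] at h1
  omega

lemma choose_add_choose_add_two_le {x y k : ℕ} (hx : 1 ≤ x) (hy : 1 ≤ y) (hk : 2 ≤ k) :
    x.choose k + (if k < x then 1 else 0) + (y.choose k + if k < y then 1 else 0) ≤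
      (x + y).choose k := by
  obtain ⟨j, rfl⟩ := Nat.exists_eq_add_of_le' (by omega : 1 ≤ k)
  have h1 := choose_add_choose_add_choose_le hx y (j := j) (by omega)
  have h2 := choose_add_choose_add_choose_le hy x (j := j) (by omega)
  rw [add_comm y x] at h2
  have h3 := choose_add_choose_le x y (by omega : 1 ≤ j + 1)
  have h4 : j + 1 < x → 2 ≤ x.choose j := fun h => two_le_choose (by omega) (by omega)
  have h5 : j + 1 < y → 2 ≤ y.choose j := fun h => two_le_choose (by omega) (by omega)
  split_ifs <;> omega

end Binomials

/-! ### Bridges -/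

/-- `v` and `b` are the ends of the only edge of `X` leaving `A`. -/
structure Bridge (G : SimpleGraph V) (X A : Finset V) (v b : V) : Prop where
  subset : A ⊆ X
  mem_left : v ∈ A
  mem_right : b ∈ X \ A
  adj : G.Adj v b
  only : ∀ x ∈ A, ∀ y ∈ X \ A, G.Adj x y → x = v ∧ y = b

section Bridges

variable {A : Finset V} {v b : V}

lemma Bridge.symm (h : Bridge G X A v b) : Bridge G X (X \ A) b v := by
  refine ⟨Finset.sdiff_subset, h.mem_right, ?_, h.adj.symm, ?_⟩
  · rw [Finset.sdiff_sdiff_eq_self h.subset]; exact h.mem_left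
  · rw [Finset.sdiff_sdiff_eq_self h.subset]
    intro x hx y hy hxy
    exact (h.only y hy x hx hxy.symm).symm

/-- The other side of the bridge is added to the class of the separation that contains `v`; the
crossing edge then found in `X` must lie inside `A`. -/
lemma Bridge.conn (h : Bridge G X A v b) (hX : Conn G X) : Conn G A := by
  rintro P ⟨p, hp, hPp⟩ ⟨q, hq, hPq⟩
  by_cases hPv : P v
  · obtain ⟨x, hx, y, hy, hx2, hy2, hxy⟩ := hX (fun t => ¬ (t ∈ A ∧ ¬ P t))
      ⟨p, h.subset hp, fun h => h.2 hPp⟩ ⟨q, h.subset hq, not_not.2 ⟨hq, hPq⟩⟩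
    rw [not_not] at hy2
    by_cases hxA : x ∈ A
    · exact ⟨x, hxA, y, hy2.1, by_contra fun h => hx2 ⟨hxA, h⟩, hy2.2, hxy⟩
    · have := (h.only y hy2.1 x (Finset.mem_sdiff.2 ⟨hx, hxA⟩) hxy.symm).1
      exact absurd (this ▸ hPv) hy2.2
  · obtain ⟨x, hx, y, hy, hx2, hy2, hxy⟩ := hX (fun t => t ∈ A ∧ P t)
      ⟨p, h.subset hp, hp, hPp⟩ ⟨q, h.subset hq, fun h => hPq h.2⟩
    by_cases hyA : y ∈ A
    · exact ⟨x, hx2.1, y, hyA, hx2.2, fun h => hy2 ⟨hyA, h⟩, hxy⟩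
    · have := (h.only x hx2.1 y (Finset.mem_sdiff.2 ⟨hy, hyA⟩) hxy).1
      exact absurd (this ▸ hx2.2) hPv

lemma Bridge.degSum (h : Bridge G X A v b) :
    degSum G X = degSum G A + degSum G (X \ A) + 2 := by
  rw [degSum_split h.subset]
  congr 1
  rw [Finset.sum_eq_single_of_mem v h.mem_left]
  · have h1 : 0 < deg G (X \ A) v := deg_pos_iff.2 ⟨b, h.mem_right, h.adj⟩
    have h2 : ¬ 2 ≤ deg G (X \ A) v := by
      rw [two_le_deg_iff]
      rintro ⟨x, hx, y, hy, hxy, h1, h2⟩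
      exact hxy ((h.only v h.mem_left x hx h1).2.trans (h.only v h.mem_left y hy h2).2.symm)
    omega
  · intro a ha hav
    by_contra hpos
    obtain ⟨y, hy, hay⟩ := deg_pos_iff.1 (Nat.pos_of_ne_zero hpos)
    exact hav (h.only a ha y hy hay).1

open Classical in
-- A cop-win set is connected, so if it meets both sides it contains both ends of the bridge.
lemma Bridge.copCount_le (h : Bridge G X A v b) (k : ℕ) :
    copCount G X (k + 1) ≤ copCount G A (k + 1) + copCount G (X \ A) (k + 1) +
      (((X.powersetCard (k + 1)).filter fun S => v ∈ S ∧ b ∈ S).filter (Good G)).card := by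
  unfold copCount
  refine le_trans (Finset.card_le_card ?_) ((Finset.card_union_le _ _).trans
    (Nat.add_le_add_right (Finset.card_union_le _ _) _))
  intro S hS
  simp only [Finset.mem_filter, Finset.mem_powersetCard, Finset.mem_union] at hS ⊢
  obtain ⟨⟨hSX, hc⟩, hg⟩ := hS
  by_cases h1 : S ⊆ A
  · exact Or.inl (Or.inl ⟨⟨h1, hc⟩, hg⟩)
  by_cases h2 : S ⊆ X \ A
  · exact Or.inl (Or.inr ⟨⟨h2, hc⟩, hg⟩)
  refine Or.inr ⟨⟨⟨hSX, hc⟩, ?_⟩, hg⟩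
  obtain ⟨y, hy, hyA⟩ := Finset.not_subset.1 h1
  obtain ⟨x, hx, hxA⟩ := Finset.not_subset.1 h2
  have hxA : x ∈ A := by
    by_contra hcon
    exact hxA (Finset.mem_sdiff.2 ⟨hSX hx, hcon⟩)
  obtain ⟨p, hp, q, hq, hpA, hqA, hpq⟩ := hg.conn (· ∈ A) ⟨x, hx, hxA⟩ ⟨y, hy, hyA⟩
  obtain ⟨rfl, rfl⟩ := h.only p hpA q (Finset.mem_sdiff.2 ⟨hSX hq, hqA⟩) hpq
  exact ⟨hp, hq⟩

open Classical in
lemma card_filter_pair_le (hvb : v ≠ b) (hv : v ∈ X) (hb : b ∈ X) (j : ℕ) :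
    ((X.powersetCard (j + 2)).filter fun S => v ∈ S ∧ b ∈ S).card ≤ (X.card - 2).choose j := by
  have hb' : b ∈ X.erase v := Finset.mem_erase.2 ⟨hvb.symm, hb⟩
  have e : ((X.erase v).erase b).card = X.card - 2 := by
    rw [Finset.card_erase_of_mem hb', Finset.card_erase_of_mem hv]; omega
  rw [← e, ← Finset.card_powersetCard]
  refine Finset.card_le_card_of_injOn (fun S => (S.erase v).erase b) ?_ ?_
  · intro S hS
    obtain ⟨hS, hvS, hbS⟩ := Finset.mem_filter.1 hS
    obtain ⟨hSX, hc⟩ := Finset.mem_powersetCard.1 hS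
    apply Finset.mem_powersetCard.2
    refine ⟨Finset.erase_subset_erase _ (Finset.erase_subset_erase _ hSX), ?_⟩
    rw [Finset.card_erase_of_mem (Finset.mem_erase.2 ⟨hvb.symm, hbS⟩),
      Finset.card_erase_of_mem hvS]
    omega
  · intro S hS T hT hST
    simp only [Finset.coe_filter, Finset.mem_powersetCard, Set.mem_ofPred_eq] at hS hT
    change (S.erase v).erase b = (T.erase v).erase b at hST
    rw [← Finset.insert_erase hS.2.1, ← Finset.insert_erase hT.2.1,
      ← Finset.insert_erase (Finset.mem_erase.2 ⟨hvb.symm, hS.2.2⟩), hST,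
      Finset.insert_erase (Finset.mem_erase.2 ⟨hvb.symm, hT.2.2⟩)]

lemma exists_bridge (hX : Conn G X) (h : ¬ Bridgeless G X) : ∃ A v b, Bridge G X A v b := by
  unfold Bridgeless at h
  push Not at h
  obtain ⟨A, hAX, ⟨a, ha⟩, hne, hlt⟩ := h
  obtain ⟨y, hy, hyA⟩ := Finset.exists_of_ssubset (hAX.ssubset_of_ne hne)
  obtain ⟨v, hv, b, hb, hvA, hbA, hvb⟩ := hX (· ∈ A) ⟨a, hAX ha, ha⟩ ⟨y, hy, hyA⟩
  have hbm : b ∈ X \ A := Finset.mem_sdiff.2 ⟨hb, hbA⟩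
  have hv1 : 0 < deg G (X \ A) v := deg_pos_iff.2 ⟨b, hbm, hvb⟩
  rw [← Finset.add_sum_erase _ _ hvA] at hlt
  refine ⟨A, v, b, hAX, hvA, hbm, hvb, fun x hx y hy hxy => ?_⟩
  have hxv : x = v := by
    by_contra hxv
    have h1 := Finset.single_le_sum (f := fun a => deg G (X \ A) a) (fun _ _ => Nat.zero_le _)
      (Finset.mem_erase.2 ⟨hxv, hx⟩)
    have h2 : 0 < deg G (X \ A) x := deg_pos_iff.2 ⟨y, hy, hxy⟩
    omega
  subst hxv
  exact ⟨rfl, eq_of_deg_le_one (by omega) hy hbm hxy hvb⟩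

end Bridges

/-! ### Induction over bridges, with the exceptional order six -/

/-- Six vertices and seven edges, plus a pendant edge. -/
lemma copCount_four_le_of_leaf {A : Finset V} {v b : V} (h : Bridge G X A v b)
    (hXA : X \ A = {b}) (hA : A.card = 6) (hsum : degSum G A = 14)
    (hcop : copCount G A 4 ≤ 11) : copCount G X 4 ≤ 20 := by
  classical
  have hb := Finset.mem_sdiff.1 h.mem_right
  have hvX := h.subset h.mem_left
  have hXe : X = insert b A := by
    rw [← Finset.sdiff_union_of_subset h.subset, hXA]; rfl
  have hcX : X.card = 7 := by rw [hXe, Finset.card_insert_of_notMem hb.2, hA]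
  have hbonly : ∀ y ∈ A, G.Adj b y → y = v := fun y hy hby =>
    (h.only y hy b h.mem_right hby.symm).1
  have h1 := h.copCount_le 3
  rw [hXA, copCount_eq_zero (X := {b}) (i := 3 + 1) (by simp)] at h1
  have h2 := card_filter_pair_le h.adj.ne hvX hb.1 2
  rw [hcX] at h2
  have e10 : (7 - 2).choose 2 = 10 := by decide
  rw [e10] at h2
  simp only [Nat.reduceAdd] at h1 h2
  -- The bridge count gives `11 + 10`, one too many; a single bad set through the bridge repairs it.
  by_cases hex : ∃ S ⊆ X, S.card = 4 ∧ v ∈ S ∧ b ∈ S ∧ ¬ Good G S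
  · obtain ⟨S, hSX, hc, hvS, hbS, hbad⟩ := hex
    set D := (X.powersetCard 4).filter fun S => v ∈ S ∧ b ∈ S with hD
    have hSD : S ∈ D := by
      rw [hD, Finset.mem_filter, Finset.mem_powersetCard]
      exact ⟨⟨hSX, hc⟩, hvS, hbS⟩
    have h3 : (D.filter (Good G)).card < D.card :=
      Finset.card_lt_card (Finset.filter_ssubset.2 ⟨S, hSD, hbad⟩)
    omega
  · have huniv : ∀ y ∈ A, y ≠ v → G.Adj v y := by
      intro y hy hyv
      by_contra hvy
      have hyb : y ≠ b := fun e => hb.2 (e ▸ hy)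
      -- If all four remaining vertices of `A` were adjacent to both `v` and `y`, there would be
      -- eight edges instead of seven. The set `{b, v, y, t}` is then disconnected.
      obtain ⟨t, ht, htv, hty, hno⟩ : ∃ t ∈ A, t ≠ v ∧ t ≠ y ∧ ¬ (G.Adj v t ∧ G.Adj y t) := by
        by_contra! hall
        have hyA' : y ∈ A.erase v := Finset.mem_erase.2 ⟨hyv, hy⟩
        set C := (A.erase v).erase y with hC
        have hcC : C.card = 4 := by
          rw [hC, Finset.card_erase_of_mem hyA', Finset.card_erase_of_mem h.mem_left, hA]
        have hCm : ∀ t ∈ C, t ∈ A ∧ t ≠ v ∧ t ≠ y := by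
          intro t ht
          simp only [hC, Finset.mem_erase] at ht
          exact ⟨ht.2.2, ht.2.1, ht.1⟩
        have hCA : C ⊆ A := fun t ht => (hCm t ht).1
        have d1 : 4 ≤ deg G A v := by
          rw [← hcC]
          exact Finset.card_le_card fun t ht => Finset.mem_filter.2
            ⟨hCA ht, (hall t (hCm t ht).1 (hCm t ht).2.1 (hCm t ht).2.2).1⟩
        have d2 : 4 ≤ deg G A y := by
          rw [← hcC]
          exact Finset.card_le_card fun t ht => Finset.mem_filter.2
            ⟨hCA ht, (hall t (hCm t ht).1 (hCm t ht).2.1 (hCm t ht).2.2).2⟩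
        have d3 : ∑ t ∈ C, 2 ≤ ∑ t ∈ C, deg G A t := by
          apply Finset.sum_le_sum
          intro t ht
          have := hall t (hCm t ht).1 (hCm t ht).2.1 (hCm t ht).2.2
          exact two_le_deg_iff.2 ⟨v, h.mem_left, y, hy, hyv.symm, this.1.symm, this.2.symm⟩
        rw [Finset.sum_const, hcC] at d3
        unfold degSum at hsum
        rw [← Finset.add_sum_erase _ _ h.mem_left, ← Finset.add_sum_erase _ _ hyA'] at hsum
        simp only [smul_eq_mul, ← hC] at d3 hsum
        omega
      have htb : t ≠ b := fun e => hb.2 (e ▸ ht)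
      refine hex ⟨{b, v, y, t}, ?_, ?_, by simp, by simp, fun hg => ?_⟩
      · simp [Finset.insert_subset_iff, hb.1, hvX, h.subset hy, h.subset ht]
      · rw [Finset.card_insert_of_notMem (by simp [h.adj.ne.symm, hyb.symm, htb.symm]),
          Finset.card_insert_of_notMem (by simp [hyv.symm, htv.symm]),
          Finset.card_insert_of_notMem (by simp [hty.symm]), Finset.card_singleton]
      · by_cases hvt : G.Adj v t
        · have hyt : ¬ G.Adj y t := fun e => hno ⟨hvt, e⟩
          obtain ⟨x, hx, hyx⟩ := hg.conn.exists_adj (s := y) (t := t) (by simp) (by simp) hty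
          simp only [Finset.mem_insert, Finset.mem_singleton] at hx
          rcases hx with rfl | rfl | rfl | rfl
          · exact hyv (hbonly y hy hyx.symm)
          · exact hvy hyx.symm
          · exact hyx.ne rfl
          · exact hyt hyx
        · obtain ⟨p, hp, q, hq, hp2, hq2, hpq⟩ := hg.conn (fun s => s = b ∨ s = v)
            ⟨b, by simp, Or.inl rfl⟩ ⟨t, by simp, by simp [htb, htv]⟩
          push Not at hq2
          simp only [Finset.mem_insert, Finset.mem_singleton, hq2.1, hq2.2, false_or] at hq
          rcases hp2 with rfl | rfl <;> rcases hq with rfl | rfl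
          · exact hyv (hbonly _ hy hpq)
          · exact htv (hbonly _ ht hpq)
          · exact hvy hpq
          · exact hvt hpq
    -- Now `v` is universal in `X`, and of the eight edges only two avoid it, too few to connect
    -- four vertices.
    have hF : copCount G (X.erase v) (3 + 1) = 0 := by
      unfold copCount
      rw [Finset.card_eq_zero, Finset.filter_eq_empty_iff]
      intro S hS hg
      rw [Finset.mem_powersetCard] at hS
      have g1 := hg.conn.two_mul_card_le hg.nonempty
      have g2 := degSum_mono (G := G) hS.1
      have g3 := degSum_erase (G := G) hvX
      have g4 := h.degSum
      have g5 : deg G X v = 6 := by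
        rw [← deg_erase_self]
        unfold deg
        rw [Finset.filter_true_of_mem, Finset.card_erase_of_mem hvX, hcX]
        intro y hy
        have hy' := Finset.mem_erase.1 hy
        rw [hXe, Finset.mem_insert] at hy'
        rcases hy'.2 with rfl | hyA
        · exact h.adj
        · exact huniv y hyA hy'.1
      have g6 : degSum G {b} = 0 := by simp [degSum, deg]
      rw [hXA] at g4
      omega
    have e1 := copCount_insert (G := G) (Finset.notMem_erase v X) 3
    have e2 := card_good_add_card_bad (G := G) (X.erase v) v 3
    rw [Finset.insert_erase hvX, hF] at e1
    rw [Finset.card_erase_of_mem hvX, hcX] at e2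
    simp only [Nat.reduceAdd] at e1
    have e20 : (7 - 1).choose 3 = 20 := by decide
    omega

/-- The amount by which the number of cop-win `(k + 1)`-sets of a connected graph with `n` vertices
and `n + c - 1` edges may exceed that of a star. -/
def excess (c n k : ℕ) : ℕ :=
  if c = 0 then 0 else if c = 1 then (if k + 1 < n then 1 else 0)
  else if n = 6 ∧ k = 3 then 1 else 0

/-- Cyclomatic numbers add across a bridge. Apart from the excluded case of order six, the
corrections themselves add up correctly unless both sides are unicyclic; then superadditivity has
enough slack. -/
lemma excess_add_le {a a' m n j : ℕ} (hm : 1 ≤ m) (hn : 1 ≤ n) (ha : a = 1 → 3 ≤ m)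
    (ha' : a' = 1 → 3 ≤ n) (hle : a + a' ≤ 2) (h : ¬ (a = 2 ∧ m = 6 ∧ j = 2))
    (h' : ¬ (a' = 2 ∧ n = 6 ∧ j = 2)) (hj : 2 ≤ j) :
    ((m - 1).choose (j + 1) + excess a m (j + 1)) + ((n - 1).choose (j + 1) + excess a' n (j + 1)) ≤
      (m - 1 + (n - 1)).choose (j + 1) + excess (a + a') (m + n) (j + 1) := by
  have hsup := choose_add_choose_le (m - 1) (n - 1) (by omega : 1 ≤ j + 1)
  by_cases h11 : a = 1 ∧ a' = 1
  · obtain ⟨rfl, rfl⟩ := h11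
    have := choose_add_choose_add_two_le (x := m - 1) (y := n - 1) (k := j + 1)
      (by have := ha rfl; omega) (by have := ha' rfl; omega) (by omega)
    simp only [excess, one_ne_zero, if_false, if_true]
    split_ifs at this ⊢ <;> omega
  · have key : excess a m (j + 1) + excess a' n (j + 1) ≤ excess (a + a') (m + n) (j + 1) := by
      clear hsup
      unfold excess
      split_ifs <;> omega
    omega

lemma three_le_card_of_cycle {A : Finset V} (hne : A.Nonempty) (h : degSum G A = 2 * A.card) :
    3 ≤ A.card := by
  obtain ⟨D, hDA, ⟨d, hd⟩, hdeg⟩ := exists_core hne h.ge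
  have h1 := hdeg d hd
  rw [← deg_erase_self] at h1
  have h2 := deg_le_card (G := G) (D.erase d) d
  rw [Finset.card_erase_of_mem hd] at h2
  have := Finset.card_le_card hDA
  omega

/-- The degree equation says that `c` is the cyclomatic number. General `c ≤ 2` is needed because
the sides of a bridge may be trees or unicyclic. -/
theorem copCount_le_choose_add_excess (X : Finset V) : ∀ c, c ≤ 2 → Conn G X → X.Nonempty →
    degSum G X + 2 = 2 * X.card + 2 * c → ∀ k, 3 ≤ k →
      copCount G X (k + 1) ≤ (X.card - 1).choose k + excess c X.card k := by
  classical
  induction X using Finset.strongInduction with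
  | H X ih =>
    intro c hc hconn hne hsum k hk
    rcases Nat.lt_or_ge (k + 1) X.card with hkX | hkX
    swap
    · exact (copCount_le_choose_of_card_le hkX).trans (Nat.le_add_right _ _)
    by_cases hB : Bridgeless G X
    · have hge : ∀ v ∈ X, 2 ≤ deg G X v := fun v hv => hB.two_le_deg (by omega) hv
      have hexc : degSum G X = ∑ v ∈ X, (deg G X v - 2) + 2 * X.card := by
        have h1 : degSum G X = ∑ v ∈ X, ((deg G X v - 2) + 2) :=
          Finset.sum_congr rfl fun v hv => by have := hge v hv; omega
        rw [h1, Finset.sum_add_distrib, Finset.sum_const, smul_eq_mul, mul_comm 2]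
      interval_cases c
      · omega
      · have h0 : ∑ v ∈ X, (deg G X v - 2) = 0 := by omega
        rw [Finset.sum_eq_zero_iff] at h0
        exact copCount_le_of_cycle hB
          (fun v hv => by have := h0 v hv; have := hge v hv; omega) (by omega)
      · exact copCount_le_of_bridgeless hB (by omega) hk
    · obtain ⟨A, v, b, hbr⟩ := exists_bridge hconn hB
      have hss : ∀ {A v b}, Bridge G X A v b → A ⊂ X := by
        intro A v b hbr
        refine hbr.subset.ssubset_of_ne ?_
        rintro rfl
        simpa using hbr.mem_right
      have hcyc : ∀ {A v b}, Bridge G X A v b → ∃ a, degSum G A + 2 = 2 * A.card + 2 * a := by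
        intro A v b hbr
        have h1 := (hbr.conn hconn).two_mul_card_le ⟨v, hbr.mem_left⟩
        obtain ⟨m, hm⟩ := even_degSum (G := G) A
        exact ⟨m + 1 - A.card, by omega⟩
      obtain ⟨a, ha⟩ := hcyc hbr
      obtain ⟨a', ha'⟩ := hcyc hbr.symm
      have hcards := Finset.card_sdiff_add_card_eq_card hbr.subset
      have hds := hbr.degSum
      have hApos := Finset.card_pos.2 ⟨v, hbr.mem_left⟩
      have hBpos := Finset.card_pos.2 ⟨b, hbr.mem_right⟩
      have haa : a + a' = c := by omega
      have h1 := ih A (hss hbr) a (by omega) (hbr.conn hconn) ⟨v, hbr.mem_left⟩ ha k hk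
      have h2 := ih _ (hss hbr.symm) a' (by omega) (hbr.symm.conn hconn) ⟨b, hbr.mem_right⟩ ha' k hk
      have h3 := hbr.copCount_le k
      obtain ⟨j, rfl⟩ := Nat.exists_eq_add_of_le' (by omega : 1 ≤ k)
      have h4 := card_filter_pair_le hbr.adj.ne (hbr.subset hbr.mem_left)
        (Finset.mem_sdiff.1 hbr.mem_right).1 j
      have h5 := Finset.card_filter_le
        ((X.powersetCard (j + 2)).filter fun S => v ∈ S ∧ b ∈ S) (Good G)
      have h6 : (X.card - 1).choose (j + 1) =
          (X.card - 2).choose j + (X.card - 2).choose (j + 1) := by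
        obtain ⟨m, hm⟩ := Nat.exists_eq_add_of_le' (by omega : 2 ≤ X.card)
        rw [hm]; exact Nat.choose_succ_succ m j
      set x := A.card - 1 with hx
      set y := (X \ A).card - 1 with hy
      have hxy : X.card - 2 = x + y := by omega
      rw [hxy] at h4 h6
      have hsup := choose_add_choose_le x y (by omega : 1 ≤ j + 1)
      have hleaf : ∀ {A v b}, Bridge G X A v b → (X \ A).card = 1 → A.card = 6 →
          degSum G A = 14 → copCount G A 4 ≤ 11 → copCount G X 4 ≤ 20 := by
        intro A v b hbr h1 h6 h14 hcop
        obtain ⟨b', hb'⟩ := Finset.card_eq_one.1 h1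
        have hbb : b = b' := by simpa [hb'] using hbr.mem_right
        exact copCount_four_le_of_leaf hbr (hbb ▸ hb') h6 h14 hcop
      have e53 : Nat.choose 5 3 = 10 := by decide
      have e52 : Nat.choose 5 2 = 10 := by decide
      have e63 : Nat.choose 6 3 = 20 := by decide
      -- When one side is the exceptional order-six set, the other is a tree. A single vertex needs
      -- the pendant-edge lemma; otherwise the binomial slack `Nat.choose 5 2` covers the surplus.
      by_cases hA2 : a = 2 ∧ A.card = 6 ∧ j = 2
      · obtain ⟨rfl, hA6, rfl⟩ := hA2
        have hx5 : x = 5 := by omega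
        have ha0 : a' = 0 := by omega
        simp only [hx5, hA6, ha0, excess] at h1 h2 h6 hsup
        norm_num at h1 h2
        rcases Nat.eq_zero_or_pos y with hy0 | hy0
        · have := hleaf hbr (by omega) hA6 (by omega) (by rw [e53] at h1; exact h1)
          have e7 : X.card = 7 := by omega
          rw [e7]
          simp only [Nat.reduceAdd, Nat.reduceSub, e63]
          omega
        · have := choose_add_choose_add_choose_le hy0 5 (j := 2) (by omega)
          rw [add_comm y 5] at this
          simp only [Nat.reduceAdd, hx5] at *
          omega
      by_cases hB2 : a' = 2 ∧ (X \ A).card = 6 ∧ j = 2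
      · obtain ⟨rfl, hA6, rfl⟩ := hB2
        have hx5 : y = 5 := by omega
        have ha0 : a = 0 := by omega
        simp only [hx5, hA6, ha0, excess] at h1 h2 h6 hsup
        norm_num at h1 h2
        rcases Nat.eq_zero_or_pos x with hy0 | hy0
        · have := hleaf hbr.symm (by rw [Finset.sdiff_sdiff_eq_self hbr.subset]; omega) hA6
            (by omega) (by rw [e53] at h2; exact h2)
          have e7 : X.card = 7 := by omega
          rw [e7]
          simp only [Nat.reduceAdd, Nat.reduceSub, e63]
          omega
        · have := choose_add_choose_add_choose_le hy0 5 (j := 2) (by omega)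
          simp only [Nat.reduceAdd, hx5] at *
          omega
      have hfin := excess_add_le (m := A.card) (n := (X \ A).card) (a := a) (a' := a') (j := j)
        hApos hBpos (fun h => three_le_card_of_cycle (G := G) ⟨v, hbr.mem_left⟩ (by omega))
        (fun h => three_le_card_of_cycle (G := G) ⟨b, hbr.mem_right⟩ (by omega)) (by omega)
        hA2 hB2 (by omega)
      rw [haa, ← hx, ← hy, show A.card + (X \ A).card = X.card by omega] at hfin
      have h7 := h3.trans (Nat.add_le_add_left (h5.trans h4) _)
      omega

/-! ### Sets of at most three vertices -/

lemma copCount_one_le : copCount G X 1 ≤ X.card := by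
  classical
  unfold copCount
  refine (Finset.card_filter_le _ _).trans ?_
  rw [Finset.card_powersetCard, Nat.choose_one_right]

lemma two_mul_copCount_two_le (X : Finset V) : 2 * copCount G X 2 ≤ degSum G X := by
  classical
  induction X using Finset.induction_on with
  | empty => rw [copCount_eq_zero (by simp)]; simp
  | insert u F hu ih =>
    rw [copCount_insert hu 1, degSum_insert hu]
    have : ((F.powersetCard 1).filter fun T => Good G (insert u T)).card ≤ deg G F u := by
      unfold deg
      refine le_trans (Finset.card_le_card ?_) (Finset.card_image_le (f := fun x => ({x} : Finset V)))
      intro T hT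
      rw [Finset.mem_filter, Finset.mem_powersetCard, Finset.card_eq_one] at hT
      obtain ⟨⟨hTF, x, rfl⟩, hg⟩ := hT
      have hxF : x ∈ F := by simpa using hTF
      obtain ⟨y, hy, huy⟩ := hg.conn.exists_adj (s := u) (t := x) (by simp) (by simp)
        (fun e => hu (e ▸ hxF))
      simp only [Finset.mem_insert, Finset.mem_singleton] at hy
      rcases hy with rfl | rfl
      · exact absurd huy (G.loopless.irrefl y)
      · exact Finset.mem_image.2 ⟨y, Finset.mem_filter.2 ⟨hxF, huy⟩, rfl⟩
    simp only [Nat.reduceAdd]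
    omega

open Classical in
/-- A cop-win triple containing `u` consists of `u` and two neighbours, or of `u` and an edge. -/
lemma card_good_pairs_le {F : Finset V} {u : V} (hu : u ∉ F) :
    ((F.powersetCard 2).filter fun T => Good G (insert u T)).card ≤
      (deg G F u).choose 2 + copCount G F 2 := by
  unfold deg
  rw [← Finset.card_powersetCard]
  unfold copCount
  refine le_trans (Finset.card_le_card ?_) (Finset.card_union_le _ _)
  intro T hT
  rw [Finset.mem_filter, Finset.mem_powersetCard] at hT
  rw [Finset.mem_union, Finset.mem_powersetCard, Finset.mem_filter, Finset.mem_powersetCard]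
  obtain ⟨⟨hTF, hc⟩, hg⟩ := hT
  by_cases hall : ∀ x ∈ T, G.Adj u x
  · exact Or.inl ⟨fun x hx => Finset.mem_filter.2 ⟨hTF hx, hall x hx⟩, hc⟩
  · refine Or.inr ⟨⟨hTF, hc⟩, ?_⟩
    push Not at hall
    obtain ⟨x, hx, hux⟩ := hall
    obtain ⟨y, hy, hxy⟩ := hg.conn.exists_adj (Finset.mem_insert_of_mem hx)
      (Finset.mem_insert_self _ _) (fun e => hu (e ▸ hTF hx))
    have hyT : y ∈ T := (Finset.mem_insert.1 hy).resolve_left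
      (fun e => hux (e ▸ hxy.symm))
    have hT2 : ({x, y} : Finset V) = T := by
      apply Finset.eq_of_subset_of_card_le
      · simp [Finset.insert_subset_iff, hx, hyT]
      · rw [hc, Finset.card_pair hxy.ne]
    rw [← hT2]
    exact good_of_dominating (c := x) (by simp) (by simp [hxy])

lemma choose_two_add (a b : ℕ) : (a + b).choose 2 = a.choose 2 + b.choose 2 + a * b := by
  induction b with
  | zero => simp
  | succ b ih =>
    have h1 := Nat.choose_succ_succ (a + b) 1
    have h2 := Nat.choose_succ_succ b 1
    simp only [Nat.succ_eq_add_one, Nat.choose_one_right, Nat.reduceAdd] at h1 h2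
    rw [← add_assoc, h1, h2, ih]
    ring

/-- A cop-win triple contains two edges, which determine it. -/
lemma copCount_three_le (X : Finset V) : ∀ q, degSum G X = 2 * q →
    copCount G X 3 ≤ q.choose 2 := by
  classical
  induction X using Finset.induction_on with
  | empty => intro q _; rw [copCount_eq_zero (by simp)]; simp
  | insert u F hu ih =>
    intro q hq
    rw [degSum_insert hu] at hq
    have h1 := card_good_pairs_le (G := G) hu
    have h2 := two_mul_copCount_two_le (G := G) F
    obtain ⟨r, hr⟩ : ∃ r, r + deg G F u = q := ⟨q - deg G F u, by omega⟩
    have h3 := ih r (by omega)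
    rw [copCount_insert hu 2, ← hr, choose_two_add]
    simp only [Nat.reduceAdd]
    rcases Nat.eq_zero_or_pos (deg G F u) with h0 | hpos
    · have : ((F.powersetCard 2).filter fun T => Good G (insert u T)).card = 0 := by
        rw [Finset.card_eq_zero, Finset.filter_eq_empty_iff]
        intro T hT hg
        rw [Finset.mem_powersetCard] at hT
        obtain ⟨x, hx⟩ := Finset.card_pos.1 (by omega : 0 < T.card)
        obtain ⟨y, hy, huy⟩ := hg.conn.exists_adj (Finset.mem_insert_self _ _)
          (Finset.mem_insert_of_mem hx) (fun e => hu (e ▸ hT.1 hx))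
        have hyF : y ∈ F := hT.1 ((Finset.mem_insert.1 hy).resolve_left huy.ne.symm)
        have : 0 < deg G F u := deg_pos_iff.2 ⟨y, hyF, huy⟩
        omega
      omega
    · have : r * 1 ≤ r * deg G F u := Nat.mul_le_mul_left r hpos
      omega

/-- If all degrees are at most three, there are at most as many cop-win triples as the sum of the
degrees. -/
lemma copCount_three_le_degSum (h : ∀ v ∈ X, deg G X v ≤ 3) : copCount G X 3 ≤ degSum G X := by
  classical
  have h1 : (X.powersetCard 3).filter (Good G) ⊆
      X.biUnion fun v => ((X.filter (G.Adj v)).powersetCard 2).image (insert v) := by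
    intro S hS
    rw [Finset.mem_filter, Finset.mem_powersetCard] at hS
    obtain ⟨⟨hSX, hc⟩, hg⟩ := hS
    have hds := hg.conn.two_mul_card_le hg.nonempty
    obtain ⟨s, hs, hd⟩ : ∃ s ∈ S, 2 ≤ deg G S s := by
      by_contra! hall
      have : degSum G S ≤ ∑ s ∈ S, 1 := Finset.sum_le_sum fun s hs => by
        have := hall s hs; omega
      simp only [Finset.sum_const, smul_eq_mul] at this
      omega
    rw [Finset.mem_biUnion]
    refine ⟨s, hSX hs, Finset.mem_image.2 ⟨S.erase s, ?_, Finset.insert_erase hs⟩⟩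
    rw [Finset.mem_powersetCard, Finset.card_erase_of_mem hs, hc]
    refine ⟨?_, rfl⟩
    have e : (S.erase s).filter (G.Adj s) = S.erase s := by
      apply Finset.eq_of_subset_of_card_le (Finset.filter_subset _ _)
      rw [← deg_erase_self] at hd
      rw [Finset.card_erase_of_mem hs, hc]
      exact hd
    intro t ht
    rw [← e, Finset.mem_filter] at ht
    exact Finset.mem_filter.2 ⟨hSX (Finset.mem_of_mem_erase ht.1), ht.2⟩
  refine (Finset.card_le_card h1).trans (Finset.card_biUnion_le.trans (Finset.sum_le_sum ?_))
  intro v hv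
  refine Finset.card_image_le.trans ?_
  rw [Finset.card_powersetCard]
  have := h v hv
  change (deg G X v).choose 2 ≤ deg G X v
  interval_cases deg G X v <;> decide

lemma two_mul_choose_two (m : ℕ) : 2 * (m + 1).choose 2 = (m + 1) * m := by
  induction m with
  | zero => rfl
  | succ m ih =>
    have h1 := Nat.choose_succ_succ (m + 1) 1
    simp only [Nat.succ_eq_add_one, Nat.choose_one_right, Nat.reduceAdd] at h1
    rw [h1, mul_add, ih]
    ring

theorem copCount_three_le_of_bicyclic (hsum : degSum G X = 2 * X.card + 2) (h7 : 7 ≤ X.card) :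
    copCount G X 3 ≤ (X.card - 1).choose 2 + 1 := by
  classical
  by_cases hd : ∀ v ∈ X, deg G X v ≤ 3
  -- The required inequality $2n+2\le\binom{n-1}{2}+1$ is an equality at $n=7$ and fails for $n=6$.
  · refine (copCount_three_le_degSum hd).trans ?_
    obtain ⟨m, hm⟩ := Nat.exists_eq_add_of_le' h7
    have := two_mul_choose_two (m + 5)
    rw [hsum, hm, show m + 7 - 1 = m + 5 + 1 by omega]
    nlinarith
  · push Not at hd
    obtain ⟨u, hu, hu4⟩ := hd
    have huF := Finset.notMem_erase u X
    have e1 := degSum_erase (G := G) hu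
    have e2 : deg G (X.erase u) u = deg G X u := deg_erase_self X u
    have hle := deg_le_card (G := G) (X.erase u) u
    have hcF := Finset.card_erase_of_mem hu
    have h1 := copCount_insert (G := G) huF 2
    have h2 := card_good_add_card_bad (G := G) (X.erase u) u 2
    have h3 := card_good_pairs_le (G := G) huF
    have h4 := two_mul_copCount_two_le (G := G) (X.erase u)
    obtain ⟨q, hq⟩ : ∃ q, degSum G (X.erase u) = 2 * q := even_iff_exists_two_mul.1 (even_degSum _)
    have h5 := copCount_three_le (X.erase u) q hq
    rw [Finset.insert_erase hu] at h1
    simp only [Nat.reduceAdd] at h1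
    -- For universal `u`, only two edges avoid it, giving at most one triple without `u`. Otherwise
    -- at least three edges avoid `u`, and triples containing `u` are counted by pairs of neighbours
    -- and by edges avoiding `u`.
    by_cases huniv : deg G X u = X.card - 1
    · have hq2 : q = 2 := by omega
      rw [hq2, Nat.choose_self] at h5
      rw [hcF] at h2
      omega
    · obtain ⟨a, ha⟩ : ∃ a, deg G X u = a + 4 := Nat.exists_eq_add_of_le' hu4
      obtain ⟨b, hb⟩ := Nat.exists_eq_add_of_le' (by omega : 3 ≤ q)
      have c1 := two_mul_choose_two (a + 3)
      have c2 := two_mul_choose_two (b + 2)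
      have c3 := two_mul_choose_two (a + b + 4)
      rw [e2, ha] at h3
      rw [hb] at h5
      rw [show X.card - 1 = a + b + 4 + 1 by omega]
      have hab : 1 ≤ a + b := by omega
      have key : (b + 3).choose 2 + ((a + 4).choose 2 + (b + 3)) ≤
          (a + b + 4 + 1).choose 2 + 1 := by
        rw [show b + 3 = b + 2 + 1 by ring, show a + 4 = a + 3 + 1 by ring]
        nlinarith [Nat.zero_le (a * b)]
      omega

/-! ### Reliability as a weighted sum of counts, and the bound for bicyclic graphs -/

variable [Fintype V]

lemma NCRel_eq_sum (G : SimpleGraph V) (p : ℝ) :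
    NCRel G p = ∑ i ∈ Finset.range (Fintype.card V + 1),
      (copCount G Finset.univ i : ℝ) * (p ^ i * (1 - p) ^ (Fintype.card V - i)) := by
  classical
  unfold NCRel
  rw [← Finset.sum_fiberwise_of_maps_to (s := Finset.univ.filter _)
    (t := Finset.range (Fintype.card V + 1)) (g := Finset.card)]
  · refine Finset.sum_congr rfl fun i _ => ?_
    rw [Finset.sum_congr rfl (g := fun _ => p ^ i * (1 - p) ^ (Fintype.card V - i)),
      Finset.sum_const, nsmul_eq_mul]
    · congr 2
      unfold copCount
      congr 1
      ext S
      simp [Good, and_comm]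
    · intro S hS
      unfold stateProb
      rw [(Finset.mem_filter.1 hS).2]
  · intro S _
    exact Finset.mem_range.2 (Nat.lt_succ_of_le (Finset.card_le_univ S))

lemma degSum_univ (G : SimpleGraph V) : degSum G Finset.univ = 2 * G.edgeSet.ncard := by
  classical
  rw [Set.ncard_eq_toFinset_card', ← SimpleGraph.edgeFinset,
    ← SimpleGraph.sum_degrees_eq_twice_card_edges]
  refine Finset.sum_congr rfl fun v _ => ?_
  unfold deg
  rw [← SimpleGraph.card_neighborFinset_eq_degree]
  congr 1
  ext x
  simp

lemma copCount_zero (X : Finset V) : copCount G X 0 = 0 := by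
  classical
  unfold copCount
  rw [Finset.card_eq_zero, Finset.filter_eq_empty_iff]
  intro S hS hg
  obtain ⟨x, hx⟩ := hg.nonempty
  rw [Finset.mem_powersetCard, Finset.card_eq_zero] at hS
  simp [hS.2] at hx

/-- The number of cop-win `i`-sets in a bicyclic graph of order `n ≥ 7` is at most
`C(n - 1, i - 1)`, with corrections for `i ≤ 3`. -/
theorem copCount_le_of_isBicyclic (h : IsBicyclic G) (h7 : 7 ≤ Fintype.card V) (k : ℕ) :
    copCount G Finset.univ (k + 1) ≤ (Fintype.card V - 1).choose k +
      (if k = 0 then Fintype.card V - 1 else if k = 1 then 2 else if k = 2 then 1 else 0) := by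
  have hsum := degSum_univ G
  rw [h.2] at hsum
  have hc : (Finset.univ : Finset V).card = Fintype.card V := Finset.card_univ
  match k with
  | 0 =>
    have := copCount_one_le (G := G) (X := Finset.univ)
    simp only [if_true, Nat.choose_zero_right, zero_add]
    omega
  | 1 =>
    have := two_mul_copCount_two_le (G := G) Finset.univ
    simp only [Nat.choose_one_right, one_ne_zero, if_false, if_true]
    simp only [Nat.reduceAdd]
    omega
  | 2 =>
    have := copCount_three_le_of_bicyclic (G := G) (X := Finset.univ) (by omega) (by omega)
    rw [hc] at this
    simpa using this
  | k + 3 =>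
    have hne : (Finset.univ : Finset V).Nonempty := Finset.card_pos.1 (by omega)
    have := copCount_le_choose_add_excess (G := G) Finset.univ 2 le_rfl (conn_of_connected h.1) hne
      (by omega) (k + 3) (by omega)
    rw [hc] at this
    unfold excess at this
    simp only [OfNat.ofNat_ne_zero, OfNat.ofNat_ne_one, if_false] at this
    -- The exceptional order six is excluded by `h7`.
    rw [if_neg (by omega)] at this
    exact this.trans (Nat.le_add_right _ _)

/-! ### The extremal graph: its edges and its cop-win sets -/

section GraphB

lemma graphB_adj {n : ℕ} {i j : Fin n} : (graphB n).Adj i j ↔ i ≠ j ∧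
    ((i.val = 0 ∨ (i.val = 1 ∧ j.val = 2) ∨ (i.val = 2 ∧ j.val = 3)) ∨
      (j.val = 0 ∨ (j.val = 1 ∧ i.val = 2) ∨ (j.val = 2 ∧ i.val = 3))) :=
  SimpleGraph.fromRel_adj _ _ _

variable {n : ℕ}

lemma graphB_adj_of_val_eq_zero {i j : Fin n} (hi : i.val = 0) (hij : i ≠ j) :
    (graphB n).Adj i j :=
  graphB_adj.2 ⟨hij, Or.inl (Or.inl hi)⟩

lemma isBicyclic_graphB (hn : 7 ≤ n) : IsBicyclic (graphB n) := by
  classical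
  have h0 : ∀ j : Fin n, (⟨0, by omega⟩ : Fin n) ≠ j → (graphB n).Adj ⟨0, by omega⟩ j :=
    fun j hj => graphB_adj_of_val_eq_zero rfl hj
  constructor
  · have : Nonempty (Fin n) := ⟨⟨0, by omega⟩⟩
    refine ⟨fun i j => ?_⟩
    have key : ∀ j, (graphB n).Reachable ⟨0, by omega⟩ j := by
      intro j
      by_cases hj : (⟨0, by omega⟩ : Fin n) = j
      · rw [hj]
      · exact (h0 j hj).reachable
    exact (key i).symm.trans (key j)
  · have hd := degSum_univ (graphB n)
    -- The edges are counted by peeling: `n - 1` at vertex `0`, then two at vertex `2`, and none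
    -- remain.
    have e1 := degSum_erase (G := graphB n) (Finset.mem_univ (⟨0, by omega⟩ : Fin n))
    set F := (Finset.univ : Finset (Fin n)).erase ⟨0, by omega⟩ with hF
    have hval : ∀ x ∈ F, x.val ≠ 0 := by
      intro x hx hx0
      exact Finset.ne_of_mem_erase hx (Fin.ext hx0)
    have hmem : ∀ x : Fin n, x.val ≠ 0 → x ∈ F := by
      intro x hx
      refine Finset.mem_erase.2 ⟨?_, Finset.mem_univ _⟩
      rintro rfl
      exact hx rfl
    have d0 : deg (graphB n) Finset.univ ⟨0, by omega⟩ = n - 1 := by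
      rw [← deg_erase_self, ← hF]
      unfold deg
      rw [Finset.filter_true_of_mem, hF, Finset.card_erase_of_mem (Finset.mem_univ _)]
      · simp
      · intro x hx
        exact h0 x (Finset.ne_of_mem_erase hx).symm
    have e2 := degSum_erase (G := graphB n) (hmem ⟨2, by omega⟩ (by simp))
    have d2 : deg (graphB n) F ⟨2, by omega⟩ = 2 := by
      unfold deg
      rw [show F.filter ((graphB n).Adj ⟨2, by omega⟩) = {⟨1, by omega⟩, ⟨3, by omega⟩} from ?_]
      · rw [Finset.card_pair]
        simp [Fin.ext_iff]
      · ext x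
        rw [Finset.mem_filter, graphB_adj, Finset.mem_insert, Finset.mem_singleton]
        simp only [Fin.ext_iff, ne_eq]
        constructor
        · rintro ⟨hx, h⟩
          have := hval x hx
          omega
        · intro h
          refine ⟨hmem x (by omega), ?_⟩
          rcases h with h | h <;> simp [h]
    have e3 : degSum (graphB n) (F.erase ⟨2, by omega⟩) = 0 := by
      refine Finset.sum_eq_zero fun x hx => ?_
      by_contra hpos
      obtain ⟨y, hy, hxy⟩ := deg_pos_iff.1 (Nat.pos_of_ne_zero hpos)
      rw [graphB_adj] at hxy
      have h1 := hval x (Finset.mem_of_mem_erase hx)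
      have h2 := hval y (Finset.mem_of_mem_erase hy)
      have h3 : x.val ≠ 2 := fun e => Finset.ne_of_mem_erase hx (Fin.ext e)
      have h4 : y.val ≠ 2 := fun e => Finset.ne_of_mem_erase hy (Fin.ext e)
      omega
    rw [Fintype.card_fin]
    omega

/-- The binomial counts the sets containing the universal vertex. The corrections are singletons,
the two edges at vertex `2` and the path through it, all avoiding the universal vertex. -/
lemma le_copCount_graphB (hn : 7 ≤ n) (k : ℕ) :
    (n - 1).choose k + (if k = 0 then n - 1 else if k = 1 then 2 else if k = 2 then 1 else 0) ≤
      copCount (graphB n) Finset.univ (k + 1) := by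
  classical
  have hadj0 : ∀ j : Fin n, (⟨0, by omega⟩ : Fin n) ≠ j → (graphB n).Adj ⟨0, by omega⟩ j :=
    fun j hj => graphB_adj_of_val_eq_zero rfl hj
  set z : Fin n := ⟨0, by omega⟩ with hz
  set F := (Finset.univ : Finset (Fin n)).erase z with hF
  have hcF : F.card = n - 1 := by
    rw [hF, Finset.card_erase_of_mem (Finset.mem_univ _)]; simp
  have h1 := copCount_insert (G := graphB n) (Finset.notMem_erase z Finset.univ) k
  rw [Finset.insert_erase (Finset.mem_univ z), ← hF] at h1
  rw [h1, Finset.filter_true_of_mem, Finset.card_powersetCard, hcF, add_comm]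
  · apply Nat.add_le_add_right
    have hmem : ∀ x : Fin n, x.val ≠ 0 → x ∈ F := by
      intro x hx
      refine Finset.mem_erase.2 ⟨?_, Finset.mem_univ _⟩
      rintro rfl
      exact hx rfl
    have a12 : (graphB n).Adj ⟨2, by omega⟩ ⟨1, by omega⟩ := graphB_adj.2 (by simp)
    have a23 : (graphB n).Adj ⟨2, by omega⟩ ⟨3, by omega⟩ := graphB_adj.2 (by simp)
    have m1 := hmem ⟨1, by omega⟩ (by simp)
    have m2 := hmem ⟨2, by omega⟩ (by simp)
    have m3 := hmem ⟨3, by omega⟩ (by simp)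
    unfold copCount
    match k with
    | 0 =>
      rw [if_pos rfl, Finset.filter_true_of_mem, Finset.card_powersetCard, hcF]
      · simp
      · intro S hS
        rw [Finset.mem_powersetCard] at hS
        obtain ⟨x, rfl⟩ := Finset.card_eq_one.1 hS.2
        exact good_of_dominating (c := x) (by simp) (by simp)
    | 1 =>
      rw [if_neg one_ne_zero, if_pos rfl, ← Nat.lt_iff_add_one_le, Finset.one_lt_card]
      refine ⟨{⟨2, by omega⟩, ⟨1, by omega⟩}, ?_, {⟨2, by omega⟩, ⟨3, by omega⟩}, ?_, ?_⟩
      · rw [Finset.mem_filter, Finset.mem_powersetCard]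
        refine ⟨⟨by simp [Finset.insert_subset_iff, m1, m2], Finset.card_pair a12.ne⟩, ?_⟩
        exact good_of_dominating (c := ⟨2, by omega⟩) (by simp) (by simp [a12])
      · rw [Finset.mem_filter, Finset.mem_powersetCard]
        refine ⟨⟨by simp [Finset.insert_subset_iff, m2, m3], Finset.card_pair a23.ne⟩, ?_⟩
        exact good_of_dominating (c := ⟨2, by omega⟩) (by simp) (by simp [a23])
      · intro e
        have : (⟨1, by omega⟩ : Fin n) ∈ ({⟨2, by omega⟩, ⟨3, by omega⟩} : Finset (Fin n)) := by
          rw [← e]; simp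
        simp [Fin.ext_iff] at this
    | 2 =>
      simp only [OfNat.ofNat_ne_zero, OfNat.ofNat_ne_one, if_false, if_true]
      rw [Nat.one_le_iff_ne_zero, ← Nat.pos_iff_ne_zero, Finset.card_pos]
      refine ⟨{⟨2, by omega⟩, ⟨1, by omega⟩, ⟨3, by omega⟩}, ?_⟩
      rw [Finset.mem_filter, Finset.mem_powersetCard]
      refine ⟨⟨by simp [Finset.insert_subset_iff, m1, m2, m3], ?_⟩, ?_⟩
      · rw [Finset.card_eq_three]
        exact ⟨_, _, _, a12.ne, a23.ne, by simp [Fin.ext_iff], rfl⟩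
      · exact good_of_dominating (c := ⟨2, by omega⟩) (by simp) (by simp [a12, a23])
    | k + 3 => simp
  · intro T hT
    refine good_of_dominating (Finset.mem_insert_self z T) fun x _ => ?_
    by_cases h : z = x
    · exact Or.inl h
    · exact Or.inr (hadj0 x h)

end GraphB

end CopWin

theorem mainTheorem2 (n : ℕ) (hn : 7 ≤ n) :
    IsBicyclic (graphB n) ∧
      ∀ (V : Type*) [Fintype V] (G : SimpleGraph V), Fintype.card V = n → IsBicyclic G →
        ∀ p : ℝ, 0 ≤ p → p ≤ 1 → NCRel G p ≤ NCRel (graphB n) p := by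
  refine ⟨CopWin.isBicyclic_graphB hn, ?_⟩
  intro V _ G hV hG p hp0 hp1
  classical
  rw [CopWin.NCRel_eq_sum, CopWin.NCRel_eq_sum, hV, Fintype.card_fin]
  refine Finset.sum_le_sum fun i _ => ?_
  refine mul_le_mul_of_nonneg_right (Nat.cast_le.2 ?_)
    (mul_nonneg (pow_nonneg hp0 _) (pow_nonneg (sub_nonneg.2 hp1) _))
  cases i with
  | zero => rw [CopWin.copCount_zero]; exact Nat.zero_le _
  | succ k =>
    have := CopWin.copCount_le_of_isBicyclic hG (by omega) k
    rw [hV] at this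
    exact this.trans (CopWin.le_copCount_graphB hn k)
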